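/- **Setting.** Let $G=(V,E)$ be a connected, locally finite, vertex-transitive graph with graph distance $d_G$, let $o\in V$, $B_k=\{x: d_G(o,x)\le k\}$, and assume that there are $d\ge 1$ and $c_G,C_G>0$ with $c_Gk^d\le|B_k|\le C_Gk^d$ for all $k\ge1$. An *admissible interaction* is a symmetric $J:V\times V\to[0,\infty)$ that is invariant under some vertex-transitive group $\Gamma$ of automorphisms of $G$, is irreducible (any $x,y$ are joined by a sequence $x=x_0,\dots,x_k=y$ with $J_{x_{i-1},x_i}>0$ for all $i$), and satisfies $J_{x,y}\le C d_G(x,y)^{-(d+\varepsilon)}$ for all $x\ne y$, for some $C,\varepsilon>0$. Admissible interactions carry the topology of the distance $\sup_x\sum_y|J_{x,y}-J'_{x,y}|$. Let $g>0$, $a\in\mathbb R$, $\beta>0$, and let $h=(h_x)_{x\in V}$ be a bounded external field (for instance constant), with the supremum norm. For $\Lambda\subset V$ finite and $\eta\in\mathbb R^V$ with $\sum_{y\notin\Lambda}J_{x,y}|\eta_y|<\infty$ for all $x\in\Lambda$, put $$H^\eta_\Lambda(\varphi)=-\sum_{\{x,y\}\subset\Lambda}J_{x,y}\varphi_x\varphi_y-\sum_{x\in\Lambda,\,y\notin\Lambda}J_{x,y}\varphi_x\eta_y-\sum_{x\in\Lambda}h_x\varphi_x,\qquad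 \varphi\in\mathbb R^\Lambda,$$ where the first sum is over unordered pairs, each counted once, with $x=y$ allowed. Let $\langle\cdot\rangle^\eta_{\Lambda}$ be the probability measure on $\mathbb R^\Lambda$ proportional to $e^{-\beta H^\eta_\Lambda(\varphi)}\prod_{x\in\Lambda}e^{-g\varphi_x^4-a\varphi_x^2}\,d\varphi_x$. A Borel probability measure $\nu$ on $\mathbb R^V$ is *tempered* if all its finite-dimensional projections are absolutely continuous with respect to Lebesgue measure and, for $\nu$-almost every $\varphi$, there is $C\in(0,\infty)$ with $\sum_{x\in B_k}\varphi_x^2\le C|B_k|$ for all $k\in\mathbb N$. It is a *Gibbs measure* for $(g,a,J,\beta,h)$ if it is tempered, for every finite $\Lambda$ the measure $\langle\cdot\rangle^\eta_\Lambda$ is well defined (i.e. the above sums converge) for $\nu$-almost every $\eta$, and $\nu(f)=\int\langle f\rangle^\eta_\Lambda\,d\nu(\eta)$ for every finite $\Lambda$ and every bounded measurable $f:\mathbb R^\Lambda\to\mathbb R$. For $\gamma,\delta>0$, a measure $\nu$ on $\mathbb R^V$ is *$(\gamma,\delta)$-regular* if for every finite $\Lambda\subset V$ its projection to $\mathbb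 R^\Lambda$ has a density with $$\frac{d\nu}{d\varphi_\Lambda}(\varphi_\Lambda)\le e^{-\sum_{x\in\Lambda}(\gamma\varphi_x^4-\delta)}\quad\text{for Lebesgue-almost every }\varphi_\Lambda .$$ **Proposition.** (1) There are functions $\gamma,\delta>0$ of $(g,a,J,\beta,h)$, depending only on $G$ and continuous on $\{g>0,\ \beta>0\}$, such that every Gibbs measure for $(g,a,J,\beta,h)$ is $(\gamma,\delta)$-regular with $\gamma=\gamma(g,a,J,\beta,h)$ and $\delta=\delta(g,a,J,\beta,h)$. (2) Let $\varepsilon,s,M>0$ and $\mathfrak p_x=\sqrt[4]{M\log(d_G(o,x)\vee1)}$. There is a function $c_1>0$ of $(g,a,K,\beta,h)$, continuous on $\{g>0,\ K>0,\ \beta>0\}$, such that the following holds. Let $J$ be an admissible interaction with $J_{x,y}\le K(d_G(x,y)\vee1)^{-(d+\varepsilon)}$ for all $x,y\in V$. Let $n\ge1$, let $\Lambda\supset B_n$ be finite, and let $\Delta\subset\Lambda$ be such that $d_G(o,x)\le n-n^{s}$ for all $x\in\Delta$. Then for every $\eta\in\mathbb R^V$ with $|\eta_z|\le\mathfrak p_z$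 for all $z\notin\Lambda$, the projection of $\langle\cdot\rangle^\eta_\Lambda$ to $\mathbb R^\Delta$ has a density bounded almost everywhere by $\exp\big(-\sum_{x\in\Delta}(\tfrac g2\varphi_x^4-c_1)\big)$, where $c_1=c_1(g,a,K,\beta,h)$. -/

import Mathlib

open MeasureTheory Set
open scoped ENNReal

/-- The ball `B_k` of radius `k` around `o` in the graph distance. -/
def graphBall {V : Type*} (G : SimpleGraph V) (o : V) (k : ℕ) : Set V :=
  {x | G.dist o x ≤ k}

/-- Polynomial growth of dimension `d`: `c k ^ d ≤ |B_k| ≤ C k ^ d` for all `k ≥ 1`. The lower bound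
forces the balls to be finite (`Set.ncard` of an infinite set is `0`) and the graph to be infinite. -/
def HasPolynomialGrowth {V : Type*} (G : SimpleGraph V) (o : V) (d : ℝ) : Prop :=
  ∃ c C : ℝ, 0 < c ∧ 0 < C ∧ ∀ k : ℕ, 1 ≤ k →
    c * (k : ℝ) ^ d ≤ ((graphBall G o k).ncard : ℝ) ∧
      ((graphBall G o k).ncard : ℝ) ≤ C * (k : ℝ) ^ d

/-- A group of automorphisms of `G` acting transitively on the vertices. -/
def IsVertexTransitiveSubgroup {V : Type*} {G : SimpleGraph V} (Γ : Subgroup (G ≃g G)) : Prop :=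
  ∀ x y : V, ∃ γ ∈ Γ, γ x = y

/-- Admissible interactions with respect to `G` and `Γ`, where `d` is the dimension of `G`. -/
structure IsAdmissible {V : Type*} (G : SimpleGraph V) (Γ : Subgroup (G ≃g G)) (d : ℝ)
    (J : V → V → ℝ) : Prop where
  symm : ∀ x y, J x y = J y x
  ferromagnetic : ∀ x y, 0 ≤ J x y
  invariant : ∀ γ ∈ Γ, ∀ x y, J (γ x) (γ y) = J x y
  irreducible : ∀ x y, Relation.ReflTransGen (fun u v => 0 < J u v) x y
  integrable : ∃ C ε : ℝ, 0 < C ∧ 0 < ε ∧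
    ∀ x y, x ≠ y → J x y ≤ C * (G.dist x y : ℝ) ^ (-(d + ε))

/-- The interactions on `G` that are admissible for some vertex-transitive group of automorphisms. -/
structure AdmissibleInteraction {V : Type*} (G : SimpleGraph V) (d : ℝ) where
  coupling : V → V → ℝ
  admissible : ∃ Γ : Subgroup (G ≃g G), IsVertexTransitiveSubgroup Γ ∧ IsAdmissible G Γ d coupling

/-- The topology on interactions is that of the distance `sup_x ∑_y |J_{x,y} - J'_{x,y}|`. -/
noncomputable instance AdmissibleInteraction.instPseudoEMetricSpace {V : Type*}
    (G : SimpleGraph V) (d : ℝ) : PseudoEMetricSpace (AdmissibleInteraction G d) where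
  edist J J' := ⨆ x, ∑' y, ‖J.coupling x y - J'.coupling x y‖ₑ
  edist_self J := by simp
  edist_comm J J' := by
    refine iSup_congr fun x => tsum_congr fun y => ?_
    rw [← enorm_neg, neg_sub]
  edist_triangle J J' J'' := by
    refine iSup_le fun x => ?_
    calc ∑' y, ‖J.coupling x y - J''.coupling x y‖ₑ
        ≤ ∑' y, (‖J.coupling x y - J'.coupling x y‖ₑ + ‖J'.coupling x y - J''.coupling x y‖ₑ) := by
          refine ENNReal.tsum_le_tsum fun y => ?_
          rw [← sub_add_sub_cancel (J.coupling x y) (J'.coupling x y) (J''.coupling x y)]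
          exact enorm_add_le _ _
      _ = ∑' y, ‖J.coupling x y - J'.coupling x y‖ₑ
          + ∑' y, ‖J'.coupling x y - J''.coupling x y‖ₑ := ENNReal.tsum_add
      _ ≤ _ := add_le_add
          (le_iSup (fun x => ∑' y, ‖J.coupling x y - J'.coupling x y‖ₑ) x)
          (le_iSup (fun x => ∑' y, ‖J'.coupling x y - J''.coupling x y‖ₑ) x)

/-- The single-site probability measure `z⁻¹ exp (- g t ^ 4 - a t ^ 2) dt` on `ℝ`. -/
noncomputable def singleSite (g a : ℝ) : Measure ℝ :=
  (volume : Measure ℝ).tilted (fun t => -g * t ^ 4 - a * t ^ 2)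

/-- The Hamiltonian on `Λ` with boundary condition `η`,
`- ∑_{{x,y} ⊆ Λ} J_{x,y} φ_x φ_y - ∑_{x ∈ Λ, y ∉ Λ} J_{x,y} φ_x η_y - ∑_{x ∈ Λ} h_x φ_x`.
In the first sum every unordered pair (with `x = y` allowed) counts once, so it is half of the sum
over ordered pairs plus half of the diagonal (`J` is symmetric). -/
noncomputable def hamiltonian {V : Type*} (J : V → V → ℝ) (h : V → ℝ) (Λ : Finset V)
    (η : V → ℝ) (φ : Λ → ℝ) : ℝ :=
  -((∑ x : Λ, ∑ y : Λ, J x y * φ x * φ y) + ∑ x : Λ, J x x * φ x * φ x) / 2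
    - (∑ x : Λ, ∑' y : {y : V // y ∉ Λ}, J x y * φ x * η y)
    - ∑ x : Λ, h x * φ x

/-- The boundary condition `η` gives absolutely convergent sums in the Hamiltonian on `Λ`. -/
def BoundarySummable {V : Type*} (J : V → V → ℝ) (Λ : Finset V) (η : V → ℝ) : Prop :=
  ∀ x ∈ Λ, Summable fun y : {y : V // y ∉ Λ} => J x y * |η y|

/-- The finite-volume `φ⁴` measure on `Λ` with boundary condition `η`: the product of the single-site
measures, reweighted by `exp (- β H)` and normalised. -/
noncomputable def phi4Measure {V : Type*} (g a : ℝ) (J : V → V → ℝ) (β : ℝ) (h : V → ℝ)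
    (Λ : Finset V) (η : V → ℝ) : Measure (Λ → ℝ) :=
  (Measure.pi fun _ : Λ => singleSite g a).tilted (fun φ => -β * hamiltonian J h Λ η φ)

/-- Tempered measures: finite-dimensional projections are absolutely continuous, and almost every
configuration satisfies `∑_{x ∈ B_k} φ_x ^ 2 ≤ C |B_k|` for all `k`, for some finite `C`. -/
structure IsTempered {V : Type*} (G : SimpleGraph V) (o : V) (ν : Measure (V → ℝ)) : Prop where
  absolutelyContinuous : ∀ Λ : Finset V, ν.map Λ.restrict ≪ (volume : Measure (Λ → ℝ))
  growth : ∀ᵐ φ ∂ν, ∃ C : ℝ, 0 < C ∧ ∀ k : ℕ,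
    ∑ᶠ x ∈ graphBall G o k, φ x ^ 2 ≤ C * ((graphBall G o k).ncard : ℝ)

/-- Gibbs measures: tempered probability measures satisfying the DLR equations, almost every
configuration being a boundary condition for which the finite-volume measures are well defined. -/
structure IsGibbs {V : Type*} (G : SimpleGraph V) (o : V) (g a : ℝ) (J : V → V → ℝ) (β : ℝ)
    (h : V → ℝ) (ν : Measure (V → ℝ)) : Prop where
  isProbabilityMeasure : IsProbabilityMeasure ν
  tempered : IsTempered G o ν
  summable : ∀ Λ : Finset V, ∀ᵐ η ∂ν, BoundarySummable J Λ η
  dlr : ∀ (Λ : Finset V) (f : (Λ → ℝ) → ℝ), Measurable f → (∃ C : ℝ, ∀ φ, |f φ| ≤ C) →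
    ∫ φ, f (Λ.restrict φ) ∂ν = ∫ η, (∫ φ, f φ ∂(phi4Measure g a J β h Λ η)) ∂ν

/-- `μ` has a density with respect to Lebesgue measure on `ℝ ^ Λ`, and this density is at most
`exp (- ∑_{x ∈ Λ} (γ φ_x ^ 4 - δ))` (almost everywhere). -/
def HasQuarticDensityBound {V : Type*} {Λ : Finset V} (γ δ : ℝ) (μ : Measure (Λ → ℝ)) : Prop :=
  μ ≪ volume ∧ ∀ᵐ φ ∂(volume : Measure (Λ → ℝ)),
    μ.rnDeriv volume φ ≤ ENNReal.ofReal (Real.exp (-∑ x : Λ, (γ * φ x ^ 4 - δ)))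

/-- `(γ, δ)`-regular measures on `ℝ ^ V`. -/
def IsRegularMeasure {V : Type*} (γ δ : ℝ) (ν : Measure (V → ℝ)) : Prop :=
  ∀ Λ : Finset V, HasQuarticDensityBound γ δ (ν.map Λ.restrict)

/-- The weakly growing configuration `𝔭_x = (M log (d(o, x) ∨ 1)) ^ (1/4)`. -/
noncomputable def plusConfig {V : Type*} (G : SimpleGraph V) (o : V) (M : ℝ) (x : V) : ℝ :=
  (M * Real.log (max (G.dist o x : ℝ) 1)) ^ (1 / 4 : ℝ)

/-! ### Energy bounds for the φ⁴ model on a finite set -/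

section Model

variable {ι : Type*} [Fintype ι]

/-! The proof is a superstability estimate in the spirit of Ruelle, run on quadratic exponential
moments. Split the spins of Λ into those on a set B and the rest. Given the rest, the spins on B
form a φ⁴ model in a modified external field. The quartic weight absorbs quadratic terms, the
inequality βξψ ≤ κξ² + β²ψ²/(4κ) decouples the two groups, and the conditional partition function is
bounded below whatever the field is, by the symmetry φ ↦ -φ. So the law on B has density at most
exp(-∑ (gφ_x⁴/2 - C)) times the expectation of exp(κ ∑_{x ∈ B} ∑_y J_{x,y} φ_y²), up to the
influence of η (`lintegral_restrict_mul_exp_phi4Exponent_le`). It remains to prove bounds E exp(∑_{x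
∈ B} φ_x²) ≤ exp(∑_{x ∈ B} v_x).

Integrating exp(∑ φ_x²) against the density bound gives a closed inequality for these moments. If
the row sums of κJ are at most 1/2, Hölder's inequality shows that each use of it halves any excess
constant in the exponent. Since the moments are finite to begin with, iteration proves the bound for
every nonnegative v ≥ r + κJv (`lintegral_exp_sum_le_of_supersolution`). The kernel k(x,y) =
(d_G(x,y) ∨ 1)^{-(d+ε)} satisfies k∗k ≤ const · k, so for small κ a constant plus the k-potential of
η² outside Λ is such a v.

For part (2), this potential is bounded at sites at depth n^s. For part (1), the small κ depends on
the decay constant of J, which the topology on interactions does not control. Further steps with κ =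
1/(2R), where R sees J only through its row sum, contract the constant to a limit free of the decay
constant, at the price of a possibly large multiple of the potential
(`exists_map_restrict₂_le_of_boundaryPotential_le`). In the DLR equations on growing balls,
temperedness sends that potential to 0. -/

/-- The logarithm of the unnormalised Lebesgue density of the `φ⁴` measure on a finite set with
couplings `J` and external field `b`. -/
noncomputable def phi4Exponent (g a β : ℝ) (J : ι → ι → ℝ) (b φ : ι → ℝ) : ℝ :=
  β * (((∑ x, ∑ y, J x y * φ x * φ y) + ∑ x, J x x * φ x * φ x) / 2 + ∑ x, b x * φ x)
    - ∑ x, (g * φ x ^ 4 + a * φ x ^ 2)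

lemma measurable_phi4Exponent (g a β : ℝ) (J : ι → ι → ℝ) (b : ι → ℝ) :
    Measurable (phi4Exponent g a β J b) := by
  unfold phi4Exponent
  fun_prop

/-- Schur's test: after |φ_x φ_y| ≤ (φ_x² + φ_y²)/2, symmetry turns column sums into row sums. -/
lemma abs_sum_sum_mul_mul_le {J : ι → ι → ℝ} {R : ℝ} (hJ : ∀ x y, 0 ≤ J x y)
    (hsymm : ∀ x y, J x y = J y x) (hrow : ∀ x, ∑ y, J x y ≤ R) (φ : ι → ℝ) :
    |∑ x, ∑ y, J x y * φ x * φ y| ≤ R * ∑ x, φ x ^ 2 := by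
  have h1 : ∑ x, ∑ y, J x y * φ x ^ 2 ≤ R * ∑ x, φ x ^ 2 := by
    rw [Finset.mul_sum]
    refine Finset.sum_le_sum fun x _ => ?_
    rw [← Finset.sum_mul]
    exact mul_le_mul_of_nonneg_right (hrow x) (sq_nonneg _)
  have h2 : ∑ x, ∑ y, J x y * φ y ^ 2 = ∑ x, ∑ y, J x y * φ x ^ 2 := by
    rw [Finset.sum_comm]
    simp_rw [hsymm]
  calc |∑ x, ∑ y, J x y * φ x * φ y| ≤ ∑ x, ∑ y, |J x y * φ x * φ y| :=
        (Finset.abs_sum_le_sum_abs _ _).trans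
          (Finset.sum_le_sum fun x _ => Finset.abs_sum_le_sum_abs _ _)
    _ ≤ ∑ x, ∑ y, (J x y * φ x ^ 2 + J x y * φ y ^ 2) / 2 := by
        refine Finset.sum_le_sum fun x _ => Finset.sum_le_sum fun y _ => ?_
        rw [mul_assoc, abs_mul, abs_of_nonneg (hJ x y), ← mul_add, mul_div_assoc]
        refine mul_le_mul_of_nonneg_left ?_ (hJ x y)
        rw [abs_le]
        constructor <;> nlinarith [sq_nonneg (φ x - φ y), sq_nonneg (φ x + φ y)]
    _ = ∑ x, ∑ y, J x y * φ x ^ 2 := by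
        simp_rw [← Finset.sum_div, Finset.sum_add_distrib]
        rw [h2]; ring
    _ ≤ _ := h1

/-- Half of the quartic weight pays for all quadratic terms: Aφ² ≤ (g/2)φ⁴ + A²/(2g), with A
collecting |a|, the couplings and `B`. The field enters only through an affine bound in t², so it
may itself contain other spins. -/
lemma phi4Exponent_le {g a β R B : ℝ} {J : ι → ι → ℝ} {b τ : ι → ℝ} (hg : 0 < g) (hβ : 0 ≤ β)
    (hJ : ∀ x y, 0 ≤ J x y) (hsymm : ∀ x y, J x y = J y x) (hrow : ∀ x, ∑ y, J x y ≤ R)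
    (hb : ∀ x t, β * (b x * t) ≤ τ x + B * t ^ 2) (φ : ι → ℝ) :
    phi4Exponent g a β J b φ
      ≤ -∑ x, (g / 2 * φ x ^ 4 - (|a| + β * R + B) ^ 2 / (2 * g)) + ∑ x, τ x := by
  have h1 := (abs_le.1 (abs_sum_sum_mul_mul_le hJ hsymm hrow φ)).2
  have h2 : ∑ x, J x x * φ x * φ x ≤ R * ∑ x, φ x ^ 2 := by
    rw [Finset.mul_sum]
    refine Finset.sum_le_sum fun x _ => ?_
    have : J x x ≤ R := (Finset.single_le_sum (fun y _ => hJ x y) (Finset.mem_univ x)).trans (hrow x)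
    nlinarith [sq_nonneg (φ x)]
  have h3 : β * ∑ x, b x * φ x ≤ ∑ x, (τ x + B * φ x ^ 2) := by
    rw [Finset.mul_sum]
    exact Finset.sum_le_sum fun x _ => hb x _
  have h4 : β * (((∑ x, ∑ y, J x y * φ x * φ y) + ∑ x, J x x * φ x * φ x) / 2)
      ≤ ∑ x, β * R * φ x ^ 2 := by
    rw [← Finset.mul_sum, mul_assoc]
    exact mul_le_mul_of_nonneg_left (by linarith) hβ
  have h5 : ∑ x, (β * R * φ x ^ 2 + (τ x + B * φ x ^ 2) - (g * φ x ^ 4 + a * φ x ^ 2))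
      ≤ ∑ x, (-(g / 2 * φ x ^ 4 - (|a| + β * R + B) ^ 2 / (2 * g)) + τ x) := by
    refine Finset.sum_le_sum fun x _ => ?_
    set A := |a| + β * R + B
    have h6 : A * φ x ^ 2 ≤ g / 2 * φ x ^ 4 + A ^ 2 / (2 * g) := by
      have : 0 ≤ (g * φ x ^ 2 - A) ^ 2 / (2 * g) := by positivity
      have e : (g * φ x ^ 2 - A) ^ 2 / (2 * g)
          = g / 2 * φ x ^ 4 + A ^ 2 / (2 * g) - A * φ x ^ 2 := by field_simp; ring
      linarith
    have h7 : -a * φ x ^ 2 ≤ |a| * φ x ^ 2 :=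
      mul_le_mul_of_nonneg_right (neg_le_abs a) (sq_nonneg _)
    have h8 : A * φ x ^ 2 = |a| * φ x ^ 2 + β * R * φ x ^ 2 + B * φ x ^ 2 := by ring
    linarith
  rw [Finset.sum_add_distrib, Finset.sum_neg_distrib, Finset.sum_sub_distrib,
    Finset.sum_add_distrib] at h5
  unfold phi4Exponent
  rw [mul_add]
  linarith

/-- Reflecting the spins removes the linear term, so the partition function is bounded below
uniformly in the external field. -/
lemma le_lintegral_exp_phi4Exponent {g a β R : ℝ} {J : ι → ι → ℝ} {b : ι → ℝ} (hg : 0 < g)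
    (hβ : 0 ≤ β) (hR : 0 ≤ R) (hJ : ∀ x y, 0 ≤ J x y) (hsymm : ∀ x y, J x y = J y x)
    (hrow : ∀ x, ∑ y, J x y ≤ R) :
    ENNReal.ofReal (Real.exp (-∑ _x : ι, (g + |a| + β * R)))
      ≤ ∫⁻ φ, ENNReal.ofReal (Real.exp (phi4Exponent g a β J b φ)) := by
  set L : (ι → ℝ) → ℝ := fun φ => β * ∑ x, b x * φ x
  set Q : (ι → ℝ) → ℝ := fun φ => phi4Exponent g a β J 0 φ
  have hQm : Measurable Q := measurable_phi4Exponent g a β J 0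
  have hLm : Measurable L := by fun_prop
  have hQL : ∀ φ, phi4Exponent g a β J b φ = Q φ + L φ := fun φ => by
    simp [Q, L, phi4Exponent]; ring
  have hQneg : ∀ φ, Q (-φ) = Q φ := fun φ => by
    simp only [Q, phi4Exponent, Pi.neg_apply, Pi.zero_apply, zero_mul, neg_sq]
    congr 2
    · congr 2; congr 1 <;> simp
    · funext x; ring
  have hLneg : ∀ φ, L (-φ) = -L φ := fun φ => by simp [L]
  have hrefl : ∫⁻ φ, ENNReal.ofReal (Real.exp (Q φ + L φ))
      = ∫⁻ φ, ENNReal.ofReal (Real.exp (Q φ - L φ)) := by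
    have := (Measure.measurePreserving_neg (volume : Measure (ι → ℝ))).lintegral_comp
      (f := fun φ => ENNReal.ofReal (Real.exp (Q φ - L φ))) (by fun_prop)
    simpa [hQneg, hLneg] using this
  have hdouble : 2 * ∫⁻ φ, ENNReal.ofReal (Real.exp (Q φ))
      ≤ 2 * ∫⁻ φ, ENNReal.ofReal (Real.exp (Q φ + L φ)) := by
    calc 2 * ∫⁻ φ, ENNReal.ofReal (Real.exp (Q φ))
        = ∫⁻ φ, 2 * ENNReal.ofReal (Real.exp (Q φ)) := by
          rw [lintegral_const_mul _ (by fun_prop)]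
      _ ≤ ∫⁻ φ, (ENNReal.ofReal (Real.exp (Q φ + L φ))
            + ENNReal.ofReal (Real.exp (Q φ - L φ))) := by
          refine lintegral_mono fun φ => ?_
          rw [← ENNReal.ofReal_add (Real.exp_pos _).le (Real.exp_pos _).le,
            show (2 : ℝ≥0∞) = ENNReal.ofReal 2 by simp, ← ENNReal.ofReal_mul (by norm_num)]
          refine ENNReal.ofReal_le_ofReal ?_
          rw [Real.exp_add, Real.exp_sub, div_eq_mul_inv, ← Real.exp_neg, ← mul_add, mul_comm]
          refine mul_le_mul_of_nonneg_left ?_ (Real.exp_pos _).le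
          linarith [Real.add_one_le_exp (L φ), Real.add_one_le_exp (-L φ)]
      _ = _ := by
          rw [lintegral_add_left (by fun_prop), ← hrefl, two_mul]
  have hhalf : ∫⁻ φ, ENNReal.ofReal (Real.exp (Q φ))
      ≤ ∫⁻ φ, ENNReal.ofReal (Real.exp (Q φ + L φ)) :=
    (ENNReal.mul_le_mul_iff_right (by norm_num) (by norm_num)).1 hdouble
  simp_rw [hQL]
  refine le_trans ?_ hhalf
  -- On this box every spin has square at most 1, and its volume is a power of 2, so restricting to
  -- it loses no constant.
  have hbox : (1 : ℝ≥0∞) ≤ volume (Set.pi univ fun _ : ι => Set.Icc (-1 : ℝ) 1) := by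
    rw [volume_pi_pi]
    refine Finset.one_le_prod' fun x _ => ?_
    rw [Real.volume_Icc]
    norm_num
  calc ENNReal.ofReal (Real.exp (-∑ _x : ι, (g + |a| + β * R)))
      ≤ ENNReal.ofReal (Real.exp (-∑ _x : ι, (g + |a| + β * R)))
        * volume (Set.pi univ fun _ : ι => Set.Icc (-1 : ℝ) 1) := le_mul_of_one_le_right' hbox
    _ = ∫⁻ φ in Set.pi univ fun _ : ι => Set.Icc (-1 : ℝ) 1,
          ENNReal.ofReal (Real.exp (-∑ _x : ι, (g + |a| + β * R))) := by
        rw [setLIntegral_const]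
    _ ≤ ∫⁻ φ in Set.pi univ fun _ : ι => Set.Icc (-1 : ℝ) 1, ENNReal.ofReal (Real.exp (Q φ)) := by
        refine setLIntegral_mono (by fun_prop) fun φ hφ => ?_
        refine ENNReal.ofReal_le_ofReal (Real.exp_le_exp.2 ?_)
        have hsq : ∀ x, φ x ^ 2 ≤ 1 := fun x => by
          have := hφ x (mem_univ x)
          exact sq_le_one_iff_abs_le_one _ |>.2 (abs_le.2 this)
        have h1 := (abs_le.1 (abs_sum_sum_mul_mul_le hJ hsymm hrow φ)).1
        have h2 : 0 ≤ ∑ x, J x x * φ x * φ x :=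
          Finset.sum_nonneg fun x _ => by
            rw [mul_assoc]; exact mul_nonneg (hJ x x) (mul_self_nonneg _)
        have h0 : 0 ≤ ∑ x, φ x ^ 2 := Finset.sum_nonneg fun x _ => sq_nonneg _
        have h3 : -∑ x, β * R * φ x ^ 2
            ≤ β * (((∑ x, ∑ y, J x y * φ x * φ y) + ∑ x, J x x * φ x * φ x) / 2) := by
          rw [← Finset.mul_sum, mul_assoc, ← mul_neg]
          refine mul_le_mul_of_nonneg_left ?_ hβ
          nlinarith [mul_nonneg hR h0]
        have h4 : ∑ x, (β * R * φ x ^ 2 + (g * φ x ^ 4 + a * φ x ^ 2))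
            ≤ ∑ _x : ι, (g + |a| + β * R) := by
          refine Finset.sum_le_sum fun x _ => ?_
          have e1 : β * R * φ x ^ 2 ≤ β * R := mul_le_of_le_one_right (by positivity) (hsq x)
          have e2 : φ x ^ 4 ≤ 1 := by
            have : φ x ^ 4 = (φ x ^ 2) ^ 2 := by ring
            rw [this]; exact pow_le_one₀ (sq_nonneg _) (hsq x)
          have e3 : a * φ x ^ 2 ≤ |a| * 1 :=
            (mul_le_mul_of_nonneg_right (le_abs_self a) (sq_nonneg _)).trans
              (mul_le_mul_of_nonneg_left (hsq x) (abs_nonneg a))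
          nlinarith
        rw [Finset.sum_add_distrib] at h4
        simp only [Q, phi4Exponent, Pi.zero_apply, zero_mul, Finset.sum_const_zero, add_zero]
        linarith
    _ ≤ _ := setLIntegral_le_lintegral _ _

/-- Conditionally on the spins off `p`, the inner spins are again a φ⁴ model, only with a shifted
field; bounds uniform in the field therefore hold conditionally. -/
lemma phi4Exponent_split {g a β : ℝ} {J : ι → ι → ℝ} {b : ι → ℝ} (hsymm : ∀ x y, J x y = J y x)
    (p : ι → Prop) [DecidablePred p] (ψ : {i // p i} → ℝ) (ξ : {i // ¬p i} → ℝ) :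
    phi4Exponent g a β J b ((MeasurableEquiv.piEquivPiSubtypeProd (fun _ => ℝ) p).symm (ψ, ξ))
      = phi4Exponent g a β (fun x y : {i // p i} => J x y)
          (fun x => b x + ∑ y : {i // ¬p i}, J x y * ξ y) ψ
        + phi4Exponent g a β (fun x y : {i // ¬p i} => J x y) (fun x => b x) ξ := by
  set φ := (MeasurableEquiv.piEquivPiSubtypeProd (fun _ : ι => ℝ) p).symm (ψ, ξ) with hφ
  have h1 : ∀ x : {i // p i}, φ x = ψ x := fun x => by
    have := x.2
    simp [hφ, MeasurableEquiv.piEquivPiSubtypeProd, Equiv.piEquivPiSubtypeProd, this]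
  have h2 : ∀ x : {i // ¬p i}, φ x = ξ x := fun x => by
    have := x.2
    simp [hφ, MeasurableEquiv.piEquivPiSubtypeProd, Equiv.piEquivPiSubtypeProd, this]
  have hs : ∀ f : ι → ℝ, ∑ x, f x = ∑ x : {i // p i}, f x + ∑ x : {i // ¬p i}, f x := fun f =>
    (Fintype.sum_subtype_add_sum_subtype p f).symm
  have hcross : ∑ x : {i // ¬p i}, ∑ y : {i // p i}, J x y * ξ x * ψ y
      = ∑ x : {i // p i}, ∑ y : {i // ¬p i}, J x y * ψ x * ξ y := by
    rw [Finset.sum_comm]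
    refine Finset.sum_congr rfl fun x _ => Finset.sum_congr rfl fun y _ => ?_
    rw [hsymm]; ring
  have hfield : ∑ x : {i // p i}, (∑ y : {i // ¬p i}, J x y * ξ y) * ψ x
      = ∑ x : {i // p i}, ∑ y : {i // ¬p i}, J x y * ψ x * ξ y := by
    refine Finset.sum_congr rfl fun x _ => ?_
    rw [Finset.sum_mul]
    exact Finset.sum_congr rfl fun y _ => by ring
  unfold phi4Exponent
  simp only [hs, h1, h2, Finset.sum_add_distrib, add_mul, hcross, hfield]
  ring

end Model

/-! ### Integrating out the outer spins -/

section Conditioning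

variable {ι : Type*} [Fintype ι]

/-- Integrating out the spins off `p`: the law of the spins on `p` under the (unnormalised) `φ⁴`
measure is controlled by a quartic density, at the price of a small quadratic exponential moment. -/
lemma lintegral_restrict_mul_exp_phi4Exponent_le {g a β R B κ C : ℝ} {J : ι → ι → ℝ}
    {b τ : ι → ℝ} (hg : 0 < g) (hβ : 0 ≤ β) (hR : 0 ≤ R) (hκ : 0 < κ)
    (hJ : ∀ x y, 0 ≤ J x y) (hsymm : ∀ x y, J x y = J y x) (hrow : ∀ x, ∑ y, J x y ≤ R)
    (hb : ∀ x t, β * (b x * t) ≤ τ x + B * t ^ 2)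
    (hC : (|a| + β * R + (B + β ^ 2 * R / (4 * κ))) ^ 2 / (2 * g) + (g + |a| + β * R) ≤ C)
    (p : ι → Prop) [DecidablePred p] {f : ({i // p i} → ℝ) → ℝ≥0∞} (hf : Measurable f) :
    ∫⁻ φ : ι → ℝ, f (fun i => φ i) * ENNReal.ofReal (Real.exp (phi4Exponent g a β J b φ))
      ≤ (∫⁻ ψ, f ψ * ENNReal.ofReal (Real.exp (-∑ x, (g / 2 * ψ x ^ 4 - C))))
        * ∫⁻ φ : ι → ℝ,
          ENNReal.ofReal (Real.exp (∑ x : {i // p i}, (τ x + κ * ∑ y, J x y * φ y ^ 2)))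
            * ENNReal.ofReal (Real.exp (phi4Exponent g a β J b φ)) := by
  set e := MeasurableEquiv.piEquivPiSubtypeProd (fun _ : ι => ℝ) p with he
  have hmp : MeasurePreserving e.symm volume volume :=
    (volume_preserving_piEquivPiSubtypeProd (fun _ : ι => ℝ) p).symm e
  have hW := measurable_phi4Exponent g a β J b
  have h1 : ∀ ψ ξ (x : {i // p i}), e.symm (ψ, ξ) x = ψ x := fun ψ ξ x => by
    have := x.2
    simp [he, MeasurableEquiv.piEquivPiSubtypeProd, Equiv.piEquivPiSubtypeProd, this]
  have h2 : ∀ ψ ξ (x : {i // ¬p i}), e.symm (ψ, ξ) x = ξ x := fun ψ ξ x => by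
    have := x.2
    simp [he, MeasurableEquiv.piEquivPiSubtypeProd, Equiv.piEquivPiSubtypeProd, this]
  have hf' : Measurable fun φ : ι → ℝ => f (fun i => φ i) := hf.comp (by fun_prop)
  rw [← hmp.lintegral_comp (by fun_prop), ← hmp.lintegral_comp (by fun_prop)]
  have hmL : Measurable fun z : ({i // p i} → ℝ) × ({i // ¬p i} → ℝ) =>
      f (fun i => e.symm z i) * ENNReal.ofReal (Real.exp (phi4Exponent g a β J b (e.symm z))) :=
    (hf'.comp hmp.measurable).mul (by fun_prop)
  rw [show (volume : Measure (({i // p i} → ℝ) × ({i // ¬p i} → ℝ))) = volume.prod volume from rfl,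
    lintegral_prod_symm' _ hmL, lintegral_prod_symm' _ (by fun_prop),
    ← lintegral_const_mul _ (by fun_prop)]
  refine lintegral_mono fun ξ => ?_
  simp only [h1]
  simp_rw [he, phi4Exponent_split hsymm, ← he]
  set JA : {i // p i} → {i // p i} → ℝ := fun x y => J x y with hJA
  set bA : {i // p i} → ℝ := fun x => b x + ∑ y : {i // ¬p i}, J x y * ξ y with hbA
  set E' := phi4Exponent g a β (fun x y : {i // ¬p i} => J x y) (fun x => b x) ξ
  set S : {i // p i} → ℝ := fun x => τ x + κ * ∑ y : {i // ¬p i}, J x y * ξ y ^ 2 with hS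
  set C₀ := (|a| + β * R + (B + β ^ 2 * R / (4 * κ))) ^ 2 / (2 * g)
  have hEm := measurable_phi4Exponent g a β JA bA
  have hsplit : ∀ (x : {i // p i}) (F : ι → ℝ),
      ∑ y, F y = ∑ y : {i // p i}, F y + ∑ y : {i // ¬p i}, F y := fun x F =>
    (Fintype.sum_subtype_add_sum_subtype p F).symm
  have hrowA : ∀ x, ∑ y, JA x y ≤ R := fun x => by
    have := hrow x
    rw [hsplit x] at this
    have h0 : 0 ≤ ∑ y : {i // ¬p i}, J x y := Finset.sum_nonneg fun y _ => hJ _ _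
    linarith
  have hrowA' : ∀ x : {i // p i}, ∑ y : {i // ¬p i}, J x y ≤ R := fun x => by
    have := hrow x
    rw [hsplit x] at this
    have h0 : 0 ≤ ∑ y : {i // p i}, J x y := Finset.sum_nonneg fun y _ => hJ _ _
    linarith
  -- The weight κ in the arithmetic-geometric inequality keeps the outer spins cheap, while the
  -- inner spins pay β²/(4κ), which the quartic term can afford.
  have hbA' : ∀ x t, β * (bA x * t) ≤ S x + (B + β ^ 2 * R / (4 * κ)) * t ^ 2 := fun x t => by
    have k1 : β * ((∑ y : {i // ¬p i}, J x y * ξ y) * t)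
        ≤ ∑ y : {i // ¬p i}, (κ * (J x y * ξ y ^ 2) + J x y * (β ^ 2 / (4 * κ) * t ^ 2)) := by
      rw [Finset.sum_mul, Finset.mul_sum]
      refine Finset.sum_le_sum fun y _ => ?_
      have k2 : β * (ξ y * t) ≤ κ * ξ y ^ 2 + β ^ 2 / (4 * κ) * t ^ 2 := by
        have : 0 ≤ (2 * κ * ξ y - β * t) ^ 2 / (4 * κ) := by positivity
        have e : (2 * κ * ξ y - β * t) ^ 2 / (4 * κ)
            = κ * ξ y ^ 2 + β ^ 2 / (4 * κ) * t ^ 2 - β * (ξ y * t) := by field_simp; ring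
        linarith
      have := mul_le_mul_of_nonneg_left k2 (hJ x y)
      linarith
    rw [Finset.sum_add_distrib, ← Finset.mul_sum, ← Finset.sum_mul] at k1
    have k3 : (∑ y : {i // ¬p i}, J x y) * (β ^ 2 / (4 * κ) * t ^ 2)
        ≤ R * (β ^ 2 / (4 * κ) * t ^ 2) :=
      mul_le_mul_of_nonneg_right (hrowA' x) (by positivity)
    have k4 := hb x t
    have k5 : R * (β ^ 2 / (4 * κ) * t ^ 2) = β ^ 2 * R / (4 * κ) * t ^ 2 := by ring
    simp only [hbA, hS, add_mul, mul_add]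
    linarith
  have hup := phi4Exponent_le (a := a) hg hβ (fun x y => hJ _ _) (fun x y => hsymm _ _) hrowA hbA'
  have hlow := le_lintegral_exp_phi4Exponent (a := a) (b := bA) hg hβ hR (fun x y => hJ _ _)
    (fun x y => hsymm _ _) hrowA
  set c := g + |a| + β * R
  set I₀ := ∫⁻ ψ : {i // p i} → ℝ,
    f ψ * ENNReal.ofReal (Real.exp (-∑ x, (g / 2 * ψ x ^ 4 - C₀)))
  have hpos : ∀ x : ℝ, 0 ≤ Real.exp x := fun x => (Real.exp_pos x).le
  have hI : ENNReal.ofReal (Real.exp (∑ _x : {i // p i}, c)) * I₀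
      ≤ ∫⁻ ψ, f ψ * ENNReal.ofReal (Real.exp (-∑ x, (g / 2 * ψ x ^ 4 - C))) := by
    rw [← lintegral_const_mul _ (by fun_prop)]
    refine lintegral_mono fun ψ => ?_
    rw [mul_left_comm, ← ENNReal.ofReal_mul (hpos _), ← Real.exp_add]
    gcongr
    rw [← Finset.sum_neg_distrib, ← Finset.sum_neg_distrib, ← Finset.sum_add_distrib]
    exact Finset.sum_le_sum fun x _ => by linarith
  -- For fixed ξ the product exp(∑ c) exp(-∑ c) = 1 is inserted. The first factor goes into `C`; the
  -- second is at most the inner partition function by `hlow`, and writing that out restores an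
  -- integral over all spins. Adding the inner squares to `S` only increases the exponent.
  calc ∫⁻ ψ, f (fun i => ψ i) * ENNReal.ofReal (Real.exp (phi4Exponent g a β JA bA ψ + E'))
      ≤ ∫⁻ ψ, (f ψ * ENNReal.ofReal (Real.exp (-∑ x, (g / 2 * ψ x ^ 4 - C₀))))
          * ENNReal.ofReal (Real.exp (∑ x, S x + E')) := by
        refine lintegral_mono fun ψ => ?_
        rw [mul_assoc, ← ENNReal.ofReal_mul (hpos _), ← Real.exp_add]
        refine mul_le_mul' le_rfl (ENNReal.ofReal_le_ofReal (Real.exp_le_exp.2 ?_))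
        have := hup ψ
        linarith
    _ = I₀ * ENNReal.ofReal (Real.exp (∑ x, S x + E')) := by
        rw [lintegral_mul_const _ (by fun_prop)]
    _ = ENNReal.ofReal (Real.exp (∑ _x : {i // p i}, c)) * I₀
          * (ENNReal.ofReal (Real.exp (-∑ _x : {i // p i}, c))
            * ENNReal.ofReal (Real.exp (∑ x, S x + E'))) := by
        have : ENNReal.ofReal (Real.exp (∑ _x : {i // p i}, c))
            * ENNReal.ofReal (Real.exp (-∑ _x : {i // p i}, c)) = 1 := by
          rw [← ENNReal.ofReal_mul (hpos _), ← Real.exp_add]; simp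
        rw [mul_mul_mul_comm, this, one_mul]
    _ ≤ _ := by
        refine mul_le_mul' hI ?_
        refine (mul_le_mul_left hlow _).trans ?_
        rw [← lintegral_mul_const _ (by fun_prop)]
        refine lintegral_mono fun ψ => ?_
        rw [← ENNReal.ofReal_mul (hpos _), ← ENNReal.ofReal_mul (hpos _), ← Real.exp_add,
          ← Real.exp_add]
        refine ENNReal.ofReal_le_ofReal (Real.exp_le_exp.2 ?_)
        have : ∑ x, S x ≤ ∑ x : {i // p i}, (τ x + κ * ∑ y, J x y * (e.symm (ψ, ξ)) y ^ 2) := by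
          refine Finset.sum_le_sum fun x _ => ?_
          rw [hsplit x]
          simp only [h1, h2, hS]
          have : 0 ≤ ∑ y : {i // p i}, J x y * ψ y ^ 2 :=
            Finset.sum_nonneg fun y _ => mul_nonneg (hJ _ _) (sq_nonneg _)
          have := mul_nonneg hκ.le this
          rw [mul_add]
          linarith
        linarith

end Conditioning

/-! ### An abstract recursion for exponential moments -/

section Moments

variable {Ω ι : Type*} [MeasurableSpace Ω] {μ : Measure Ω}

/-- Hölder's inequality with exponents 1/t and 1/(1-t): the logarithm of an exponential moment is
convex in the exponent. -/
lemma lintegral_exp_convex_le {X Y : Ω → ℝ} (hX : Measurable X) (hY : Measurable Y) {P Q t : ℝ}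
    (ht0 : 0 ≤ t) (ht1 : t ≤ 1)
    (hP : ∫⁻ ω, ENNReal.ofReal (Real.exp (X ω)) ∂μ ≤ ENNReal.ofReal (Real.exp P))
    (hQ : ∫⁻ ω, ENNReal.ofReal (Real.exp (Y ω)) ∂μ ≤ ENNReal.ofReal (Real.exp Q)) :
    ∫⁻ ω, ENNReal.ofReal (Real.exp (t * X ω + (1 - t) * Y ω)) ∂μ
      ≤ ENNReal.ofReal (Real.exp (t * P + (1 - t) * Q)) := by
  have key : ∀ x y : ℝ, ENNReal.ofReal (Real.exp (t * x + (1 - t) * y))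
      = ENNReal.ofReal (Real.exp x) ^ t * ENNReal.ofReal (Real.exp y) ^ (1 - t) := fun x y => by
    rw [ENNReal.ofReal_rpow_of_pos (Real.exp_pos _), ENNReal.ofReal_rpow_of_pos (Real.exp_pos _),
      ← ENNReal.ofReal_mul (by positivity), ← Real.exp_mul, ← Real.exp_mul, ← Real.exp_add,
      mul_comm x, mul_comm y]
  simp_rw [key]
  refine (ENNReal.lintegral_mul_norm_pow_le (by fun_prop) (by fun_prop) ht0 (by linarith)
    (by ring)).trans ?_
  gcongr

variable [Fintype ι]

/-- Exponential moments along indicators extend to the whole cube by log-convexity. -/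
lemma lintegral_exp_sum_mul_le_of_indicator {X : ι → Ω → ℝ} (hX : ∀ x, Measurable (X x))
    {v : ι → ℝ} {K : ℝ}
    (H : ∀ B : Finset ι, ∫⁻ ω, ENNReal.ofReal (Real.exp (∑ x ∈ B, X x ω)) ∂μ
      ≤ ENNReal.ofReal (Real.exp (K + ∑ x ∈ B, v x)))
    {θ : ι → ℝ} (hθ0 : ∀ x, 0 ≤ θ x) (hθ1 : ∀ x, θ x ≤ 1) :
    ∫⁻ ω, ENNReal.ofReal (Real.exp (∑ x, θ x * X x ω)) ∂μ
      ≤ ENNReal.ofReal (Real.exp (K + ∑ x, θ x * v x)) := by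
  classical
  -- Induction on the set `T` of coordinates at which θ may be fractional.
  suffices h : ∀ T : Finset ι, ∀ θ : ι → ℝ, (∀ x, 0 ≤ θ x) → (∀ x, θ x ≤ 1) →
      (∀ x ∉ T, θ x = 0 ∨ θ x = 1) →
      ∫⁻ ω, ENNReal.ofReal (Real.exp (∑ x, θ x * X x ω)) ∂μ
        ≤ ENNReal.ofReal (Real.exp (K + ∑ x, θ x * v x)) from
    h Finset.univ θ hθ0 hθ1 fun x hx => absurd (Finset.mem_univ x) hx
  intro T
  induction T using Finset.induction_on with
  | empty =>
    intro θ _ _ hθ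
    have hs : ∀ F : ι → ℝ, ∑ x, θ x * F x = ∑ x ∈ Finset.univ.filter (fun x => θ x = 1), F x := by
      intro F
      rw [Finset.sum_filter]
      refine Finset.sum_congr rfl fun x _ => ?_
      rcases hθ x (by simp) with h | h <;> simp [h]
    simp_rw [hs]
    exact H _
  | insert a T _ ih =>
    intro θ h0 h1 hθ
    have hup : ∀ c : ℝ, 0 ≤ c → c ≤ 1 → (c = 0 ∨ c = 1) →
        ∫⁻ ω, ENNReal.ofReal (Real.exp (∑ x, Function.update θ a c x * X x ω)) ∂μ
          ≤ ENNReal.ofReal (Real.exp (K + ∑ x, Function.update θ a c x * v x)) := by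
      intro c hc0 hc1 hc
      refine ih _ (fun x => ?_) (fun x => ?_) (fun x hx => ?_)
      · by_cases hxa : x = a
        · subst hxa; simpa using hc0
        · simpa [hxa] using h0 x
      · by_cases hxa : x = a
        · subst hxa; simpa using hc1
        · simpa [hxa] using h1 x
      · by_cases hxa : x = a
        · subst hxa; simpa using hc
        · simpa [hxa] using hθ x (by simp [hxa, hx])
    -- At the coordinate `a`, θ is the convex combination, with weight θ a, of its versions with
    -- value 1 and 0 there.
    have hcomb : ∀ F : ι → ℝ, ∑ x, θ x * F x = θ a * ∑ x, Function.update θ a 1 x * F x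
        + (1 - θ a) * ∑ x, Function.update θ a 0 x * F x := by
      intro F
      rw [Finset.mul_sum, Finset.mul_sum, ← Finset.sum_add_distrib]
      refine Finset.sum_congr rfl fun x _ => ?_
      by_cases hxa : x = a
      · subst hxa; simp
      · simp [hxa]; ring
    have := lintegral_exp_convex_le (by fun_prop) (by fun_prop) (h0 a) (h1 a)
      (hup 1 zero_le_one le_rfl (Or.inr rfl)) (hup 0 le_rfl zero_le_one (Or.inl rfl))
    simp_rw [hcomb]
    refine this.trans_eq ?_
    congr 2
    ring

/-- The source of contraction: 2θ still lies in the cube, and θ is the midpoint of 2θ and 0. The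
zero exponent costs nothing because the mass is at most 1, so `K` is halved while the term linear in
`v` is not changed. -/
lemma lintegral_exp_sum_mul_le_of_le_half (hμ : μ univ ≤ 1) {X : ι → Ω → ℝ}
    (hX : ∀ x, Measurable (X x)) {v : ι → ℝ} {K : ℝ}
    (H : ∀ B : Finset ι, ∫⁻ ω, ENNReal.ofReal (Real.exp (∑ x ∈ B, X x ω)) ∂μ
      ≤ ENNReal.ofReal (Real.exp (K + ∑ x ∈ B, v x)))
    {θ : ι → ℝ} (hθ0 : ∀ x, 0 ≤ θ x) (hθ1 : ∀ x, θ x ≤ 1 / 2) :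
    ∫⁻ ω, ENNReal.ofReal (Real.exp (∑ x, θ x * X x ω)) ∂μ
      ≤ ENNReal.ofReal (Real.exp (K / 2 + ∑ x, θ x * v x)) := by
  have h1 := lintegral_exp_sum_mul_le_of_indicator hX H (θ := fun x => 2 * θ x)
    (fun x => by linarith [hθ0 x]) (fun x => by linarith [hθ1 x])
  have h2 : ∫⁻ _ω, ENNReal.ofReal (Real.exp (0 : ℝ)) ∂μ ≤ ENNReal.ofReal (Real.exp 0) := by
    simpa using hμ
  have h3 := lintegral_exp_convex_le (t := 1 / 2) (by fun_prop) measurable_const (by norm_num)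
    (by norm_num) h1 h2
  have hs : ∀ F : ι → ℝ, ∑ x, θ x * F x = 1 / 2 * ∑ x, 2 * θ x * F x := fun F => by
    rw [Finset.mul_sum]
    exact Finset.sum_congr rfl fun x _ => by ring
  simp_rw [hs]
  rw [show K / 2 + 1 / 2 * ∑ x, 2 * θ x * v x
    = 1 / 2 * (K + ∑ x, 2 * θ x * v x) + (1 - 1 / 2) * 0 by ring]
  simpa only [mul_zero, add_zero] using h3

variable {X : ι → Ω → ℝ} {q : ι → ι → ℝ} {r v v' : ι → ℝ} {K : ℝ}

/-- After exchanging the sums, site y carries the weight ∑_{x ∈ B} q x y, at most a column sum. -/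
lemma lintegral_exp_sum_sum_mul_le (hμ : μ univ ≤ 1) (hX : ∀ x, Measurable (X x))
    (hq : ∀ x y, 0 ≤ q x y) (hcol : ∀ y, ∑ x, q x y ≤ 1 / 2)
    (H : ∀ B : Finset ι, ∫⁻ ω, ENNReal.ofReal (Real.exp (∑ x ∈ B, X x ω)) ∂μ
      ≤ ENNReal.ofReal (Real.exp (K + ∑ x ∈ B, v x))) (B : Finset ι) :
    ∫⁻ ω, ENNReal.ofReal (Real.exp (∑ x ∈ B, ∑ y, q x y * X y ω)) ∂μ
      ≤ ENNReal.ofReal (Real.exp (K / 2 + ∑ x ∈ B, ∑ y, q x y * v y)) := by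
  have h := lintegral_exp_sum_mul_le_of_le_half hμ hX H (θ := fun y => ∑ x ∈ B, q x y)
    (fun y => Finset.sum_nonneg fun x _ => hq x y)
    (fun y => (Finset.sum_le_univ_sum_of_nonneg fun x => hq x y).trans (hcol y))
  have hs : ∀ F : ι → ℝ, ∑ x ∈ B, ∑ y, q x y * F y = ∑ y, (∑ x ∈ B, q x y) * F y := fun F => by
    rw [Finset.sum_comm]
    simp_rw [Finset.sum_mul]
  simpa only [hs] using h

/-- One step of the moment recursion. -/
lemma lintegral_exp_sum_le_step (hμ : μ univ ≤ 1) (hX : ∀ x, Measurable (X x))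
    (hq : ∀ x y, 0 ≤ q x y) (hcol : ∀ y, ∑ x, q x y ≤ 1 / 2)
    (hstep : ∀ B : Finset ι, ∫⁻ ω, ENNReal.ofReal (Real.exp (∑ x ∈ B, X x ω)) ∂μ
      ≤ ENNReal.ofReal (Real.exp (∑ x ∈ B, r x))
        * ∫⁻ ω, ENNReal.ofReal (Real.exp (∑ x ∈ B, ∑ y, q x y * X y ω)) ∂μ)
    (hv : ∀ x, r x + ∑ y, q x y * v y ≤ v' x)
    (H : ∀ B : Finset ι, ∫⁻ ω, ENNReal.ofReal (Real.exp (∑ x ∈ B, X x ω)) ∂μ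
      ≤ ENNReal.ofReal (Real.exp (K + ∑ x ∈ B, v x))) (B : Finset ι) :
    ∫⁻ ω, ENNReal.ofReal (Real.exp (∑ x ∈ B, X x ω)) ∂μ
      ≤ ENNReal.ofReal (Real.exp (K / 2 + ∑ x ∈ B, v' x)) := by
  refine (hstep B).trans ((mul_le_mul' le_rfl
    (lintegral_exp_sum_sum_mul_le hμ hX hq hcol H B)).trans ?_)
  rw [← ENNReal.ofReal_mul (Real.exp_pos _).le, ← Real.exp_add]
  refine ENNReal.ofReal_le_ofReal (Real.exp_le_exp.2 ?_)
  have := Finset.sum_le_sum fun x (_ : x ∈ B) => hv x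
  rw [Finset.sum_add_distrib] at this
  linarith

/-- A nonnegative supersolution of the moment recursion bounds the exponential moments as soon as
these are finite. -/
lemma lintegral_exp_sum_le_of_supersolution (hμ : μ univ ≤ 1) (hX : ∀ x, Measurable (X x))
    (hX0 : ∀ x ω, 0 ≤ X x ω)
    (hq : ∀ x y, 0 ≤ q x y) (hcol : ∀ y, ∑ x, q x y ≤ 1 / 2)
    (hstep : ∀ B : Finset ι, ∫⁻ ω, ENNReal.ofReal (Real.exp (∑ x ∈ B, X x ω)) ∂μ
      ≤ ENNReal.ofReal (Real.exp (∑ x ∈ B, r x))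
        * ∫⁻ ω, ENNReal.ofReal (Real.exp (∑ x ∈ B, ∑ y, q x y * X y ω)) ∂μ)
    (hv0 : ∀ x, 0 ≤ v x) (hv : ∀ x, r x + ∑ y, q x y * v y ≤ v x)
    (hfin : ∫⁻ ω, ENNReal.ofReal (Real.exp (∑ x, X x ω)) ∂μ ≠ ∞) (B : Finset ι) :
    ∫⁻ ω, ENNReal.ofReal (Real.exp (∑ x ∈ B, X x ω)) ∂μ
      ≤ ENNReal.ofReal (Real.exp (∑ x ∈ B, v x)) := by
  set E := ∫⁻ ω, ENNReal.ofReal (Real.exp (∑ x, X x ω)) ∂μ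
  -- A crude start with K = E, from E ≤ exp E; nonnegativity of `X` lets the full sum dominate the
  -- sum over `B`.
  have hK : ∀ B : Finset ι, ∫⁻ ω, ENNReal.ofReal (Real.exp (∑ x ∈ B, X x ω)) ∂μ
      ≤ ENNReal.ofReal (Real.exp (E.toReal + ∑ x ∈ B, v x)) := fun B => by
    have h1 : E ≤ ENNReal.ofReal (Real.exp (E.toReal + ∑ x ∈ B, v x)) := by
      rw [← ENNReal.ofReal_toReal hfin]
      refine ENNReal.ofReal_le_ofReal ?_
      rw [ENNReal.ofReal_toReal hfin]
      have := Real.add_one_le_exp (E.toReal + ∑ x ∈ B, v x)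
      have := Finset.sum_nonneg fun x (_ : x ∈ B) => hv0 x
      linarith
    refine le_trans (lintegral_mono fun ω => ENNReal.ofReal_le_ofReal (Real.exp_le_exp.2 ?_)) h1
    exact Finset.sum_le_univ_sum_of_nonneg fun x => hX0 x ω
  have hiter : ∀ k : ℕ, ∀ B : Finset ι, ∫⁻ ω, ENNReal.ofReal (Real.exp (∑ x ∈ B, X x ω)) ∂μ
      ≤ ENNReal.ofReal (Real.exp (E.toReal * (1 / 2) ^ k + ∑ x ∈ B, v x)) := by
    intro k
    induction k with
    | zero => simpa using hK
    | succ k ih =>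
      intro B
      refine (lintegral_exp_sum_le_step hμ hX hq hcol hstep hv ih B).trans_eq ?_
      congr 3
      ring
  have hlim : Filter.Tendsto
      (fun k : ℕ => ENNReal.ofReal (Real.exp (E.toReal * (1 / 2) ^ k + ∑ x ∈ B, v x)))
      Filter.atTop (nhds (ENNReal.ofReal (Real.exp (E.toReal * 0 + ∑ x ∈ B, v x)))) := by
    refine ENNReal.tendsto_ofReal ((Real.continuous_exp.tendsto _).comp ?_)
    exact ((tendsto_pow_atTop_nhds_zero_of_lt_one (by norm_num) (by norm_num)).const_mul _).add_const _
  have := ge_of_tendsto' hlim fun k => hiter k B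
  simpa using this

end Moments

/-! ### Polynomially decaying kernels on a graph of polynomial growth -/

section Kernel

variable {V : Type*} {G : SimpleGraph V} {o : V} {d : ℝ}

lemma dist_apply_iso_le (hconn : G.Connected) (γ : G ≃g G) (x y : V) :
    G.dist (γ x) (γ y) ≤ G.dist x y := by
  obtain ⟨w, hw⟩ := hconn.exists_walk_length_eq_dist x y
  rw [← hw]
  simpa using SimpleGraph.dist_le (w.map γ.toHom)

lemma dist_apply_iso (hconn : G.Connected) (γ : G ≃g G) (x y : V) :
    G.dist (γ x) (γ y) = G.dist x y := by
  refine le_antisymm (dist_apply_iso_le hconn γ x y) ?_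
  simpa using dist_apply_iso_le hconn γ.symm (γ x) (γ y)

lemma finite_graphBall (hgrowth : HasPolynomialGrowth G o d) (k : ℕ) : (graphBall G o k).Finite := by
  obtain ⟨c, C, hc, -, h⟩ := hgrowth
  -- The growth bound starts at radius 1, hence the shift that also covers k = 0.
  have h1 : (graphBall G o (k + 1)).Finite := by
    refine Set.finite_of_ncard_pos ?_
    have := (h (k + 1) (by omega)).1
    have h2 : 0 < c * ((k + 1 : ℕ) : ℝ) ^ d := by positivity
    exact_mod_cast h2.trans_le this
  exact h1.subset fun x (hx : G.dist o x ≤ k) => show G.dist o x ≤ k + 1 by omega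

/-- The kernel `(d(x, y) ∨ 1) ^ (-q)`. -/
noncomputable def decayKernel (G : SimpleGraph V) (q : ℝ) (x y : V) : ℝ :=
  max (G.dist x y : ℝ) 1 ^ (-q)

lemma max_dist_pos (G : SimpleGraph V) (x y : V) : 0 < max (G.dist x y : ℝ) 1 :=
  lt_max_of_lt_right one_pos

lemma decayKernel_pos (q : ℝ) (x y : V) : 0 < decayKernel G q x y :=
  Real.rpow_pos_of_pos (max_dist_pos G x y) _

lemma decayKernel_comm (q : ℝ) (x y : V) : decayKernel G q x y = decayKernel G q y x := by
  rw [decayKernel, SimpleGraph.dist_comm]; rfl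

/-- Change of base point: d_G(o,z) ∨ 1 ≤ (1 + d_G(o,x)) (d_G(x,z) ∨ 1). It carries summability at
`o` to all sites. -/
lemma decayKernel_le_mul (hconn : G.Connected) {q : ℝ} (hq : 0 ≤ q) (x z : V) :
    decayKernel G q x z ≤ (1 + G.dist o x : ℝ) ^ q * decayKernel G q o z := by
  have h1 : max (G.dist o z : ℝ) 1 ≤ (1 + G.dist o x) * max (G.dist x z : ℝ) 1 := by
    have ht : (G.dist o z : ℝ) ≤ G.dist o x + G.dist x z := by
      exact_mod_cast hconn.dist_triangle
    have h0 : (0 : ℝ) ≤ G.dist o x := Nat.cast_nonneg _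
    have h2 := le_max_left (G.dist x z : ℝ) 1
    have h3 := le_max_right (G.dist x z : ℝ) 1
    refine max_le ?_ ?_ <;> nlinarith
  rw [decayKernel, decayKernel, Real.rpow_neg (max_dist_pos G x z).le,
    Real.rpow_neg (max_dist_pos G o z).le, ← div_eq_mul_inv,
    le_div_iff₀ (Real.rpow_pos_of_pos (max_dist_pos G o z) _), inv_mul_le_iff₀
    (Real.rpow_pos_of_pos (max_dist_pos G x z) _), mul_comm (max (G.dist x z : ℝ) 1 ^ q),
    ← Real.mul_rpow (by positivity) (max_dist_pos G x z).le]
  exact Real.rpow_le_rpow (max_dist_pos G o z).le h1 hq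

/-- By the triangle inequality the larger of the two truncated distances is at least half of that
between x and z, so its factor is at most 2^q k(x,z). Summed over y, this says that k∗k is bounded
by a multiple of k. -/
lemma decayKernel_mul_le (hconn : G.Connected) {q : ℝ} (hq : 0 ≤ q) (x y z : V) :
    decayKernel G q x y * decayKernel G q y z
      ≤ 2 ^ q * decayKernel G q x z * (decayKernel G q x y + decayKernel G q y z) := by
  have key : ∀ u v : V, max (G.dist x z : ℝ) 1 ≤ 2 * max (G.dist u v : ℝ) 1 →
      decayKernel G q u v ≤ 2 ^ q * decayKernel G q x z := by
    intro u v h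
    rw [decayKernel, decayKernel, Real.rpow_neg (max_dist_pos G u v).le,
      Real.rpow_neg (max_dist_pos G x z).le, ← div_eq_mul_inv,
      le_div_iff₀ (Real.rpow_pos_of_pos (max_dist_pos G x z) _), inv_mul_le_iff₀
      (Real.rpow_pos_of_pos (max_dist_pos G u v) _), mul_comm (max (G.dist u v : ℝ) 1 ^ q),
      ← Real.mul_rpow (by positivity) (max_dist_pos G u v).le]
    exact Real.rpow_le_rpow (max_dist_pos G x z).le h hq
  have ht : (G.dist x z : ℝ) ≤ G.dist x y + G.dist y z := by
    exact_mod_cast hconn.dist_triangle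
  have hA := decayKernel_pos (G := G) q x y
  have hB := decayKernel_pos (G := G) q y z
  have hC : 0 < 2 ^ q * decayKernel G q x z :=
    mul_pos (by positivity) (decayKernel_pos (G := G) q x z)
  rcases le_total (max (G.dist x y : ℝ) 1) (max (G.dist y z : ℝ) 1) with h | h
  · have := key y z (max_le (by
      linarith [le_max_left (G.dist x y : ℝ) 1, le_max_left (G.dist y z : ℝ) 1])
      (by linarith [le_max_right (G.dist y z : ℝ) 1]))
    nlinarith
  · have := key x y (max_le (by
      linarith [le_max_left (G.dist x y : ℝ) 1, le_max_left (G.dist y z : ℝ) 1])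
      (by linarith [le_max_right (G.dist x y : ℝ) 1]))
    nlinarith

/-- Polynomially growing ball sums are summable against the kernel, by a dyadic decomposition. -/
lemma summable_decayKernel_mul (hfin : ∀ k, (graphBall G o k).Finite) {ε C : ℝ} (hd : 0 ≤ d)
    (hε : 0 < ε) {b : V → ℝ} (hb : ∀ x, 0 ≤ b x)
    (hC : ∀ k : ℕ, 1 ≤ k → ∑ᶠ x ∈ graphBall G o k, b x ≤ C * (k : ℝ) ^ d) :
    Summable fun z => decayKernel G (d + ε) o z * b z := by
  set q := d + ε
  have hq : 0 < q := by positivity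
  -- With j the integer part of log₂(d_G(o,z) ∨ 1), the site z lies in the ball of radius 2^(j+1)
  -- and k(o,z) ≤ 2^(-jq).
  have hker : ∀ z, ENNReal.ofReal (decayKernel G q o z * b z)
      ≤ ∑' j : ℕ, ENNReal.ofReal (((2 : ℝ) ^ j) ^ (-q))
          * (graphBall G o (2 ^ (j + 1))).indicator (fun z => ENNReal.ofReal (b z)) z := by
    intro z
    set m := max (G.dist o z) 1
    have hm : m ≠ 0 := by simp only [m]; omega
    have h1 : 2 ^ Nat.log 2 m ≤ m := Nat.pow_log_le_self 2 hm
    have h2 : m < 2 ^ (Nat.log 2 m + 1) := Nat.lt_pow_succ_log_self (by norm_num) m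
    refine le_trans ?_ (ENNReal.le_tsum (Nat.log 2 m))
    have hz : z ∈ graphBall G o (2 ^ (Nat.log 2 m + 1)) := (le_max_left _ _).trans h2.le
    rw [indicator_of_mem hz, ← ENNReal.ofReal_mul (by positivity)]
    refine ENNReal.ofReal_le_ofReal (mul_le_mul_of_nonneg_right ?_ (hb z))
    have hcast : max (G.dist o z : ℝ) 1 = (m : ℝ) := by simp [m]
    rw [decayKernel, hcast]
    exact Real.rpow_le_rpow_of_nonpos (by positivity) (by exact_mod_cast h1) (by linarith)
  have hball : ∀ k, ∑' z, (graphBall G o k).indicator (fun z => ENNReal.ofReal (b z)) z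
      = ENNReal.ofReal (∑ᶠ x ∈ graphBall G o k, b x) := by
    intro k
    rw [finsum_mem_eq_finite_toFinset_sum _ (hfin k), ENNReal.ofReal_sum_of_nonneg fun x _ => hb x,
      tsum_eq_sum (s := (hfin k).toFinset) fun z hz => indicator_of_notMem (by simpa using hz) _]
    exact Finset.sum_congr rfl fun z hz => indicator_of_mem (by simpa using hz) _
  -- The volume growth 2^(jd) cancels against the decay 2^(-j(d+ε)), leaving a geometric series of
  -- ratio 2^(-ε).
  have hgeom : ∀ j : ℕ, ENNReal.ofReal (((2 : ℝ) ^ j) ^ (-q))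
      * ENNReal.ofReal (∑ᶠ x ∈ graphBall G o (2 ^ (j + 1)), b x)
      ≤ ENNReal.ofReal (C * 2 ^ d * (2 ^ (-ε)) ^ j) := by
    intro j
    rw [← ENNReal.ofReal_mul (by positivity)]
    refine ENNReal.ofReal_le_ofReal ?_
    refine (mul_le_mul_of_nonneg_left (hC _ Nat.one_le_two_pow) (by positivity)).trans_eq ?_
    have e1 : ((2 : ℝ) ^ j) ^ (-q) = ((2 : ℝ) ^ j) ^ (-d) * ((2 : ℝ) ^ j) ^ (-ε) := by
      rw [← Real.rpow_add (by positivity)]; congr 1; simp only [q]; ring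
    have e2 : (((2 ^ (j + 1) : ℕ) : ℝ)) ^ d = ((2 : ℝ) ^ j) ^ d * 2 ^ d := by
      push_cast
      rw [pow_succ, Real.mul_rpow (by positivity) (by norm_num)]
    have e3 : ((2 : ℝ) ^ j) ^ (-d) * ((2 : ℝ) ^ j) ^ d = 1 := by
      rw [← Real.rpow_add (by positivity)]; simp
    have e4 : ((2 : ℝ) ^ j) ^ (-ε) = (2 ^ (-ε)) ^ j := by
      rw [← Real.rpow_natCast, ← Real.rpow_mul (by norm_num), ← Real.rpow_natCast,
        ← Real.rpow_mul (by norm_num), mul_comm]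
    rw [e1, e2, e4]
    linear_combination (C * 2 ^ d * (2 ^ (-ε)) ^ j) * e3
  have hC0 : 0 ≤ C := by
    have := hC 1 le_rfl
    have h0 : 0 ≤ ∑ᶠ x ∈ graphBall G o 1, b x := by
      rw [finsum_mem_eq_finite_toFinset_sum _ (hfin 1)]
      exact Finset.sum_nonneg fun x _ => hb x
    simpa using h0.trans this
  have hsum : Summable fun j : ℕ => C * 2 ^ d * ((2 : ℝ) ^ (-ε)) ^ j :=
    (summable_geometric_of_lt_one (by positivity)
      (Real.rpow_lt_one_of_one_lt_of_neg (by norm_num) (by linarith))).mul_left _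
  have hlt : ∑' z, ENNReal.ofReal (decayKernel G q o z * b z) < ∞ := by
    calc ∑' z, ENNReal.ofReal (decayKernel G q o z * b z)
        ≤ ∑' z, ∑' j : ℕ, ENNReal.ofReal (((2 : ℝ) ^ j) ^ (-q))
          * (graphBall G o (2 ^ (j + 1))).indicator (fun z => ENNReal.ofReal (b z)) z :=
          ENNReal.tsum_le_tsum hker
      _ = ∑' j : ℕ, ENNReal.ofReal (((2 : ℝ) ^ j) ^ (-q))
          * ENNReal.ofReal (∑ᶠ x ∈ graphBall G o (2 ^ (j + 1)), b x) := by
          rw [ENNReal.tsum_comm]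
          simp_rw [ENNReal.tsum_mul_left, hball]
      _ ≤ ∑' j : ℕ, ENNReal.ofReal (C * 2 ^ d * (2 ^ (-ε)) ^ j) := ENNReal.tsum_le_tsum hgeom
      _ = ENNReal.ofReal (∑' j : ℕ, C * 2 ^ d * (2 ^ (-ε)) ^ j) :=
          (ENNReal.ofReal_tsum_of_nonneg (fun j => by positivity) hsum).symm
      _ < ∞ := ENNReal.ofReal_lt_top
  have := ENNReal.summable_toReal hlt.ne
  refine this.congr fun z => ?_
  rw [ENNReal.toReal_ofReal (mul_nonneg (decayKernel_pos q o z).le (hb z))]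

lemma exists_hasSum_decayKernel (hconn : G.Connected) (htrans : ∀ x y : V, ∃ γ : G ≃g G, γ x = y)
    (hd : 0 ≤ d) (hgrowth : HasPolynomialGrowth G o d) {ε : ℝ} (hε : 0 < ε) :
    ∃ S : ℝ, 0 < S ∧ ∀ x, HasSum (decayKernel G (d + ε) x) S := by
  have hfin := finite_graphBall hgrowth
  have ho : Summable (decayKernel G (d + ε) o) := by
    obtain ⟨c, C, -, -, h⟩ := hgrowth
    refine (summable_decayKernel_mul hfin hd hε (b := fun _ => 1) (C := C) (fun _ => zero_le_one)
      fun k hk => ?_).congr fun z => mul_one _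
    rw [finsum_mem_eq_finite_toFinset_sum _ (hfin k)]
    simpa [Set.ncard_eq_toFinset_card _ (hfin k)] using (h k hk).2
  refine ⟨∑' y, decayKernel G (d + ε) o y, ho.tsum_pos (fun y => (decayKernel_pos _ _ _).le) o
    (decayKernel_pos _ _ _), fun x => ?_⟩
  obtain ⟨γ, hγ⟩ := htrans o x
  have h := ho.hasSum
  rw [← γ.symm.toEquiv.hasSum_iff] at h
  convert h using 1
  funext y
  simp only [Function.comp, decayKernel]
  rw [← dist_apply_iso hconn γ o, hγ]
  simp

/-- Convolving the kernel with a potential of the kernel. -/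
lemma sum_decayKernel_mul_tsum_le (hconn : G.Connected) {q S : ℝ} (hq : 0 ≤ q)
    (hS : ∀ x, HasSum (decayKernel G q x) S) {b : V → ℝ} (hb : ∀ x, 0 ≤ b x)
    (hsum : ∀ x, Summable fun z => decayKernel G q x z * b z) (Λ : Finset V) (x : V) :
    ∑ y ∈ Λ, decayKernel G q x y * ∑' z, decayKernel G q y z * b z
      ≤ 2 ^ q * (2 * S) * ∑' z, decayKernel G q x z * b z := by
  have hS' : ∀ z, ∑ y ∈ Λ, decayKernel G q z y ≤ S := fun z =>
    sum_le_hasSum Λ (fun y _ => (decayKernel_pos _ _ _).le) (hS z)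
  simp_rw [← tsum_mul_left]
  rw [← Summable.tsum_finsetSum fun y _ => (hsum y).mul_left _]
  refine Summable.tsum_le_tsum (fun z => ?_) (summable_sum fun y _ => (hsum y).mul_left _)
    ((hsum x).mul_left _)
  calc ∑ y ∈ Λ, decayKernel G q x y * (decayKernel G q y z * b z)
      ≤ ∑ y ∈ Λ, 2 ^ q * decayKernel G q x z * (decayKernel G q x y + decayKernel G q z y) * b z := by
        refine Finset.sum_le_sum fun y _ => ?_
        rw [← mul_assoc, decayKernel_comm q z y]
        exact mul_le_mul_of_nonneg_right (decayKernel_mul_le hconn hq x y z) (hb z)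
    _ = 2 ^ q * (∑ y ∈ Λ, decayKernel G q x y + ∑ y ∈ Λ, decayKernel G q z y)
          * (decayKernel G q x z * b z) := by
        rw [← Finset.sum_mul, ← Finset.mul_sum, Finset.sum_add_distrib]; ring
    _ ≤ _ := by
        refine mul_le_mul_of_nonneg_right (mul_le_mul_of_nonneg_left ?_ (by positivity))
          (mul_nonneg (decayKernel_pos _ _ _).le (hb z))
        linarith [hS' x, hS' z]

end Kernel

/-! ### Densities of product measures -/

section PiDensity

lemma lintegral_fin_prod_eq_prod {E : Type*} [MeasurableSpace E] {μ : Measure E} [SigmaFinite μ]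
    {n : ℕ} {f : Fin n → E → ℝ≥0∞} (hf : ∀ i, Measurable (f i)) :
    ∫⁻ x : Fin n → E, ∏ i, f i (x i) ∂(Measure.pi fun _ => μ) = ∏ i, ∫⁻ x, f i x ∂μ := by
  induction n with
  | zero => simp
  | succ n ih =>
    rw [Fin.prod_univ_succ, ← ih fun i => hf i.succ,
      ← lintegral_prod_mul (hf 0).aemeasurable (Finset.measurable_prod _ fun i _ =>
        (hf i.succ).comp (measurable_pi_apply i)).aemeasurable,
      ← ((measurePreserving_piFinSuccAbove (fun _ : Fin (n + 1) => μ) 0).symm).lintegral_comp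
        (by fun_prop)]
    simp_rw [MeasurableEquiv.piFinSuccAbove_symm_apply, Fin.insertNthEquiv,
      Fin.prod_univ_succ, Fin.insertNth_zero, Equiv.coe_fn_mk, Fin.cons_succ, Fin.cons_zero]
    rfl

variable {ι : Type*} [Fintype ι]

lemma lintegral_fintype_prod_eq_prod {E : Type*} [MeasurableSpace E] {μ : Measure E}
    [SigmaFinite μ] {f : ι → E → ℝ≥0∞} (hf : ∀ i, Measurable (f i)) :
    ∫⁻ x : ι → E, ∏ i, f i (x i) ∂(Measure.pi fun _ => μ) = ∏ i, ∫⁻ x, f i x ∂μ := by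
  let e := (Fintype.equivFin ι).symm
  rw [← (measurePreserving_piCongrLeft (fun _ : ι => μ) e).lintegral_comp (by fun_prop)]
  simp_rw [← e.prod_comp, MeasurableEquiv.coe_piCongrLeft, Equiv.piCongrLeft_apply_apply]
  exact lintegral_fin_prod_eq_prod fun i => hf (e i)

lemma pi_withDensity {E : Type*} [MeasurableSpace E] {μ : Measure E} [SigmaFinite μ]
    {w : E → ℝ} (hw : Measurable w) :
    Measure.pi (fun _ : ι => μ.withDensity fun x => ENNReal.ofReal (w x))
      = (Measure.pi fun _ : ι => μ).withDensity fun x => ∏ i, ENNReal.ofReal (w (x i)) := by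
  refine Measure.pi_eq fun s hs => ?_
  rw [withDensity_apply _ (MeasurableSet.univ_pi hs), ← lintegral_indicator (MeasurableSet.univ_pi hs)]
  have h1 : ∀ x : ι → E, (univ.pi s).indicator (fun x => ∏ i, ENNReal.ofReal (w (x i))) x
      = ∏ i, (s i).indicator (fun t => ENNReal.ofReal (w t)) (x i) := by
    intro x
    by_cases hx : x ∈ univ.pi s
    · rw [indicator_of_mem hx]
      exact Finset.prod_congr rfl fun i _ =>
        (indicator_of_mem (hx i (mem_univ i)) fun t => ENNReal.ofReal (w t)).symm
    · rw [indicator_of_notMem hx]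
      simp only [mem_pi, mem_univ, true_imp_iff, not_forall] at hx
      obtain ⟨i, hi⟩ := hx
      exact (Finset.prod_eq_zero (Finset.mem_univ i) (indicator_of_notMem hi _)).symm
  simp_rw [h1]
  rw [lintegral_fintype_prod_eq_prod fun i =>
    (show Measurable fun t => ENNReal.ofReal (w t) by fun_prop).indicator (hs i)]
  exact Finset.prod_congr rfl fun i _ => by
    rw [lintegral_indicator (hs i), withDensity_apply _ (hs i)]

end PiDensity

/-! ### The moment recursion for finite-volume measures -/

section FiniteVolume

variable {V : Type*}

/-- The external field on `Λ` including the interaction with the boundary condition. -/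
noncomputable def effectiveField (J : V → V → ℝ) (h : V → ℝ) (Λ : Finset V) (η : V → ℝ) (x : Λ) : ℝ :=
  h x + ∑' y : {y : V // y ∉ Λ}, J x y * η y

/-- Both normalisations are hidden in the factor `k`. The estimates below are homogeneous in the
measure, so neither its value nor its positivity matters; a vanishing Bochner integral would merely
give k = 0. -/
lemma exists_phi4Measure_eq_smul (g a : ℝ) (J : V → V → ℝ) (β : ℝ) (h : V → ℝ) (Λ : Finset V)
    (η : V → ℝ) :
    ∃ k : ℝ≥0∞, k ≠ ∞ ∧ phi4Measure g a J β h Λ η = k • (volume : Measure (Λ → ℝ)).withDensity fun φ =>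
      ENNReal.ofReal (Real.exp
        (phi4Exponent g a β (fun x y : Λ => J x y) (effectiveField J h Λ η) φ)) := by
  have hH : ∀ φ : Λ → ℝ, -β * hamiltonian J h Λ η φ + ∑ x, (-g * φ x ^ 4 - a * φ x ^ 2)
      = phi4Exponent g a β (fun x y : Λ => J x y) (effectiveField J h Λ η) φ := by
    intro φ
    have h1 : ∀ x : Λ, ∑' y : {y : V // y ∉ Λ}, J x y * φ x * η y
        = (∑' y : {y : V // y ∉ Λ}, J x y * η y) * φ x := fun x => by
      rw [← tsum_mul_right]
      exact tsum_congr fun y => by ring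
    have h2 : ∑ x : Λ, (-g * φ x ^ 4 - a * φ x ^ 2) = -∑ x : Λ, (g * φ x ^ 4 + a * φ x ^ 2) := by
      rw [← Finset.sum_neg_distrib]
      exact Finset.sum_congr rfl fun x _ => by ring
    unfold hamiltonian phi4Exponent effectiveField
    simp_rw [h1, h2, add_mul, Finset.sum_add_distrib]
    ring
  have hHm : Measurable fun φ : Λ → ℝ => -β * hamiltonian J h Λ η φ := by
    have : (fun φ : Λ → ℝ => -β * hamiltonian J h Λ η φ) = fun φ =>
        phi4Exponent g a β (fun x y : Λ => J x y) (effectiveField J h Λ η) φ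
          - ∑ x, (-g * φ x ^ 4 - a * φ x ^ 2) := by
      funext φ; rw [← hH]; ring
    rw [this]
    exact (measurable_phi4Exponent _ _ _ _ _).sub (by fun_prop)
  unfold phi4Measure singleSite Measure.tilted
  set z := ∫ t : ℝ, Real.exp (-g * t ^ 4 - a * t ^ 2)
  rw [pi_withDensity (by fun_prop)]
  set Z := ∫ φ : Λ → ℝ, Real.exp (-β * hamiltonian J h Λ η φ) ∂_
  rw [← withDensity_mul _ (by fun_prop) (by fun_prop)]
  have hz : 0 ≤ z := integral_nonneg fun t => (Real.exp_pos _).le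
  have hZ : 0 ≤ Z := integral_nonneg fun t => (Real.exp_pos _).le
  refine ⟨ENNReal.ofReal ((z ^ Fintype.card Λ)⁻¹ * Z⁻¹), ENNReal.ofReal_ne_top, ?_⟩
  have hm := measurable_phi4Exponent g a β (fun x y : Λ => J x y) (effectiveField J h Λ η)
  rw [← withDensity_smul _ (by fun_prop)]
  congr 1
  funext φ
  simp only [Pi.mul_apply, Pi.smul_apply, smul_eq_mul]
  rw [← ENNReal.ofReal_prod_of_nonneg fun x _ => div_nonneg (Real.exp_pos _).le hz,
    ← ENNReal.ofReal_mul (Finset.prod_nonneg fun x _ => div_nonneg (Real.exp_pos _).le hz),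
    ← ENNReal.ofReal_mul (by positivity), ← hH, Real.exp_add, Real.exp_sum, Finset.prod_div_distrib,
    Finset.prod_const, Finset.card_univ]
  congr 1
  ring

lemma phi4Measure_univ_le_one (g a : ℝ) (J : V → V → ℝ) (β : ℝ) (h : V → ℝ) (Λ : Finset V)
    (η : V → ℝ) : phi4Measure g a J β h Λ η univ ≤ 1 := by
  rcases isZeroOrProbabilityMeasure_tilted.measure_univ
    (μ := (phi4Measure g a J β h Λ η)) with h | h <;> simp [h]

/-- Completing the square, t² - (g/2)t⁴ ≤ 2/g - t² ≤ 2R - t²; what remains is a Gaussian integral,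
and √π ≤ e accounts for the final 1. -/
lemma lintegral_exp_sq_sub_quartic_le {g R C : ℝ} (hg : 0 < g) (hgR : 1 ≤ R * g) :
    ∫⁻ t : ℝ, ENNReal.ofReal (Real.exp (t ^ 2 - (g / 2 * t ^ 4 - C)))
      ≤ ENNReal.ofReal (Real.exp (C + 2 * R + 1)) := by
  have h1 : ∀ t : ℝ, t ^ 2 - (g / 2 * t ^ 4 - C) ≤ (C + 2 * R) + -1 * t ^ 2 := by
    intro t
    have h2 : 2 * t ^ 2 - g / 2 * t ^ 4 ≤ 2 / g := by
      have : 0 ≤ (g * t ^ 2 - 2) ^ 2 / (2 * g) := by positivity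
      have e : (g * t ^ 2 - 2) ^ 2 / (2 * g) = g / 2 * t ^ 4 - 2 * t ^ 2 + 2 / g := by
        field_simp; ring
      linarith
    have h3 : 2 / g ≤ 2 * R := by rw [div_le_iff₀ hg]; linarith
    linarith
  have hsqrt : √(Real.pi / 1) ≤ Real.exp 1 := by
    rw [Real.sqrt_le_left (Real.exp_pos _).le, div_one]
    have := Real.exp_one_gt_d9
    nlinarith [Real.pi_lt_d2]
  calc ∫⁻ t : ℝ, ENNReal.ofReal (Real.exp (t ^ 2 - (g / 2 * t ^ 4 - C)))
      ≤ ∫⁻ t : ℝ, ENNReal.ofReal (Real.exp (C + 2 * R)) * ENNReal.ofReal (Real.exp (-1 * t ^ 2)) := by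
        refine lintegral_mono fun t => ?_
        rw [← ENNReal.ofReal_mul (Real.exp_pos _).le, ← Real.exp_add]
        exact ENNReal.ofReal_le_ofReal (Real.exp_le_exp.2 (h1 t))
    _ = ENNReal.ofReal (Real.exp (C + 2 * R)) * ENNReal.ofReal (√(Real.pi / 1)) := by
        rw [lintegral_const_mul _ (by fun_prop), ← integral_gaussian,
          ofReal_integral_eq_lintegral_ofReal (integrable_exp_neg_mul_sq one_pos)
            (Filter.Eventually.of_forall fun t => (Real.exp_pos _).le)]
    _ ≤ _ := by
        rw [← ENNReal.ofReal_mul (Real.exp_pos _).le, Real.exp_add (C + 2 * R) 1]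
        exact ENNReal.ofReal_le_ofReal (mul_le_mul_of_nonneg_left hsqrt (Real.exp_pos _).le)

lemma lintegral_exp_sum_sq_mul_quartic_le {ι : Type*} [Fintype ι] {g R C : ℝ} (hg : 0 < g)
    (hgR : 1 ≤ R * g) :
    ∫⁻ ψ : ι → ℝ, ENNReal.ofReal (Real.exp (∑ x, ψ x ^ 2))
        * ENNReal.ofReal (Real.exp (-∑ x, (g / 2 * ψ x ^ 4 - C)))
      ≤ ENNReal.ofReal (Real.exp (∑ _x : ι, (C + 2 * R + 1))) := by
  have h1 : ∀ ψ : ι → ℝ, ENNReal.ofReal (Real.exp (∑ x, ψ x ^ 2))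
      * ENNReal.ofReal (Real.exp (-∑ x, (g / 2 * ψ x ^ 4 - C)))
      = ∏ x, ENNReal.ofReal (Real.exp (ψ x ^ 2 - (g / 2 * ψ x ^ 4 - C))) := fun ψ => by
    rw [← ENNReal.ofReal_mul (Real.exp_pos _).le, ← Real.exp_add, ← sub_eq_add_neg,
      ← Finset.sum_sub_distrib, Real.exp_sum,
      ENNReal.ofReal_prod_of_nonneg fun x _ => (Real.exp_pos _).le]
  simp_rw [h1]
  rw [volume_pi, lintegral_fintype_prod_eq_prod
    (f := fun _ t => ENNReal.ofReal (Real.exp (t ^ 2 - (g / 2 * t ^ 4 - C)))) fun i => by fun_prop]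
  refine (Finset.prod_le_prod' fun x _ => lintegral_exp_sq_sub_quartic_le hg hgR).trans_eq ?_
  rw [← ENNReal.ofReal_prod_of_nonneg fun x _ => (Real.exp_pos _).le, ← Real.exp_sum]

/-- The constant of a single step of the moment recursion, for parameters bounded by `R` and
influence `κ` of the outer spins. -/
noncomputable def stepConst (R κ : ℝ) : ℝ :=
  (R + R * R + ((R ^ 2 + R ^ 3 / (4 * κ)) + R ^ 2 * R / (4 * κ))) ^ 2 * R + (R + R + R * R)
    + R ^ 2 + 2 * R + 1

lemma stepConst_pos {R κ : ℝ} (hR : 0 < R) (hκ : 0 < κ) : 0 < stepConst R κ := by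
  unfold stepConst; positivity

/-- `R` controls all parameters of the model, and `η` has finite quadratic influence. -/
structure ParameterBound (R g a : ℝ) (J : V → V → ℝ) (β : ℝ) (h η : V → ℝ) : Prop where
  g_pos : 0 < g
  g_le : g ≤ R
  one_le_mul : 1 ≤ R * g
  abs_a_le : |a| ≤ R
  β_nonneg : 0 ≤ β
  β_le : β ≤ R
  abs_h_le : ∀ x, |h x| ≤ R
  nonneg : ∀ x y, 0 ≤ J x y
  symm : ∀ x y, J x y = J y x
  summable : ∀ x, Summable (J x)
  tsum_le : ∀ x, ∑' y, J x y ≤ R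
  summable_sq : ∀ x, Summable fun y => J x y * η y ^ 2

variable {R g a β : ℝ} {J : V → V → ℝ} {h η : V → ℝ}

/-- The quadratic influence of the boundary condition on the site `x`. -/
noncomputable def boundaryInfluence (J : V → V → ℝ) (Λ : Finset V) (η : V → ℝ) (x : V) : ℝ :=
  ∑' y : {y : V // y ∉ Λ}, J x y * η y ^ 2

namespace ParameterBound

lemma R_pos (P : ParameterBound R g a J β h η) : 0 < R := P.g_pos.trans_le P.g_le

lemma sum_le (P : ParameterBound R g a J β h η) (Λ : Finset V) (x : V) : ∑ y : Λ, J x y ≤ R := by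
  rw [Finset.sum_coe_sort Λ (J x)]
  exact ((P.summable x).sum_le_tsum _ fun y _ => P.nonneg x y).trans (P.tsum_le x)

/-- The affine bound in t² required by `phi4Exponent_le`: the field `h` contributes R²(1 + t²), and
the boundary spins are separated by the arithmetic-geometric inequality with weight κ. -/
lemma mul_effectiveField_le (P : ParameterBound R g a J β h η) {κ : ℝ} (hκ : 0 < κ) (Λ : Finset V)
    (x : Λ) (t : ℝ) :
    β * (effectiveField J h Λ η x * t)
      ≤ (R ^ 2 + κ * boundaryInfluence J Λ η x) + (R ^ 2 + R ^ 3 / (4 * κ)) * t ^ 2 := by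
  have hinj : Function.Injective ((↑) : {y : V // y ∉ Λ} → V) := Subtype.val_injective
  have s1 : Summable fun y : {y : V // y ∉ Λ} => J x y := (P.summable x).comp_injective hinj
  have s2 : Summable fun y : {y : V // y ∉ Λ} => J x y * η y ^ 2 :=
    (P.summable_sq x).comp_injective hinj
  have hβ := P.β_nonneg
  have hR := P.R_pos
  have h1 : β * (h x * t) ≤ R ^ 2 + R ^ 2 * t ^ 2 := by
    have e1 : h x * t ≤ R * (1 + t ^ 2) := by
      calc h x * t ≤ |h x| * |t| := (le_abs_self _).trans (abs_mul _ _).le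
        _ ≤ R * (1 + t ^ 2) := by
          refine mul_le_mul (P.abs_h_le x) ?_ (abs_nonneg _) hR.le
          nlinarith [sq_abs t, sq_nonneg (|t| - 1)]
    calc β * (h x * t) ≤ β * (R * (1 + t ^ 2)) := mul_le_mul_of_nonneg_left e1 hβ
      _ ≤ R * (R * (1 + t ^ 2)) := mul_le_mul_of_nonneg_right P.β_le (by positivity)
      _ = _ := by ring
  have bound : ∀ y : {y : V // y ∉ Λ}, J x y * (β * t * η y)
      ≤ κ * (J x y * η y ^ 2) + β ^ 2 / (4 * κ) * t ^ 2 * J x y := fun y => by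
    have k2 : β * t * η y ≤ κ * η y ^ 2 + β ^ 2 / (4 * κ) * t ^ 2 := by
      have : 0 ≤ (2 * κ * η y - β * t) ^ 2 / (4 * κ) := by positivity
      have e : (2 * κ * η y - β * t) ^ 2 / (4 * κ)
          = κ * η y ^ 2 + β ^ 2 / (4 * κ) * t ^ 2 - β * t * η y := by field_simp; ring
      linarith
    have := mul_le_mul_of_nonneg_left k2 (P.nonneg x y)
    linarith
  have s3 : Summable fun y : {y : V // y ∉ Λ} => J x y * η y := by
    refine Summable.of_norm_bounded (s2.add s1) fun y => ?_
    rw [Real.norm_eq_abs, abs_mul, abs_of_nonneg (P.nonneg _ _)]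
    have : |η y| ≤ η y ^ 2 + 1 := by nlinarith [sq_abs (η y), sq_nonneg (|η y| - 1)]
    have := mul_le_mul_of_nonneg_left this (P.nonneg x y)
    linarith
  have h2 : β * ((∑' y : {y : V // y ∉ Λ}, J x y * η y) * t)
      ≤ κ * boundaryInfluence J Λ η x + β ^ 2 / (4 * κ) * t ^ 2 * ∑' y : {y : V // y ∉ Λ}, J x y := by
    rw [boundaryInfluence, ← tsum_mul_right, ← tsum_mul_left, ← tsum_mul_left, ← tsum_mul_left,
      ← (s2.mul_left κ).tsum_add (s1.mul_left _)]
    refine Summable.tsum_le_tsum (fun y => ?_) ((s3.mul_right _).mul_left _)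
      ((s2.mul_left κ).add (s1.mul_left _))
    refine (le_of_eq ?_).trans (bound y)
    ring
  have h3 : ∑' y : {y : V // y ∉ Λ}, J x y ≤ R :=
    ((P.summable x).tsum_subtype_le _ _ (P.nonneg x)).trans (P.tsum_le x)
  have h4 : β ^ 2 / (4 * κ) * t ^ 2 * ∑' y : {y : V // y ∉ Λ}, J x y ≤ R ^ 3 / (4 * κ) * t ^ 2 := by
    calc _ ≤ R ^ 2 / (4 * κ) * t ^ 2 * R := by
          have := P.β_le
          exact mul_le_mul (by gcongr) h3 (tsum_nonneg fun y => P.nonneg x y) (by positivity)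
      _ = _ := by ring
  rw [effectiveField, add_mul, mul_add]
  linarith

/-- Each parameter is replaced by `R`. The reserve R² is for the constant produced by `h`, and 2R +
1 for the single-site Gaussian integral. -/
lemma quad_const_le (P : ParameterBound R g a J β h η) {κ : ℝ} (hκ : 0 < κ) :
    (|a| + β * R + ((R ^ 2 + R ^ 3 / (4 * κ)) + β ^ 2 * R / (4 * κ))) ^ 2 / (2 * g)
      + (g + |a| + β * R) ≤ stepConst R κ - R ^ 2 - 2 * R - 1 := by
  have hR := P.R_pos
  have hg := P.g_pos
  have h1 := P.β_le
  have h0 := P.β_nonneg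
  have h2 := P.abs_a_le
  have h3 := P.g_le
  have hinv : 1 / (2 * g) ≤ R := by
    rw [div_le_iff₀ (by positivity)]
    have := P.one_le_mul
    linarith
  have e : stepConst R κ - R ^ 2 - 2 * R - 1
      = (R + R * R + ((R ^ 2 + R ^ 3 / (4 * κ)) + R ^ 2 * R / (4 * κ))) ^ 2 * R + (R + R + R * R) := by
    unfold stepConst; ring
  rw [e, div_eq_mul_one_div]
  gcongr

/-- Used twice: with f = exp(∑ ψ_x²) it gives the moment recursion, with f an indicator it gives the
density bound. -/
lemma lintegral_restrict_le (P : ParameterBound R g a J β h η) {κ : ℝ} (hκ : 0 < κ) (Λ : Finset V)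
    (p : Λ → Prop) [DecidablePred p] {f : ({i // p i} → ℝ) → ℝ≥0∞} (hf : Measurable f) :
    ∫⁻ φ, f (fun i => φ i) ∂(phi4Measure g a J β h Λ η)
      ≤ (∫⁻ ψ, f ψ * ENNReal.ofReal
          (Real.exp (-∑ x, (g / 2 * ψ x ^ 4 - (stepConst R κ - 2 * R - 1)))))
        * ∫⁻ φ, ENNReal.ofReal (Real.exp (∑ x : {i // p i},
            (κ * boundaryInfluence J Λ η x + ∑ y : Λ, κ * J x y * φ y ^ 2)))
              ∂(phi4Measure g a J β h Λ η) := by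
  obtain ⟨k, -, hk⟩ := exists_phi4Measure_eq_smul g a J β h Λ η
  have hm := measurable_phi4Exponent g a β (fun x y : Λ => J x y) (effectiveField J h Λ η)
  have hf' : Measurable fun φ : Λ → ℝ => f (fun i => φ i) := hf.comp (by fun_prop)
  have hg := P.g_pos
  have key := lintegral_restrict_mul_exp_phi4Exponent_le P.g_pos P.β_nonneg P.R_pos.le hκ
    (fun x y : Λ => P.nonneg x y) (fun x y => P.symm x y) (fun x => P.sum_le Λ x)
    (fun x t => P.mul_effectiveField_le hκ Λ x t) (P.quad_const_le hκ) p hf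
  have hI : ∀ ψ : {i // p i} → ℝ,
      Real.exp (-∑ x, (g / 2 * ψ x ^ 4 - (stepConst R κ - 2 * R - 1)))
        = Real.exp (∑ _x : {i // p i}, R ^ 2)
          * Real.exp (-∑ x, (g / 2 * ψ x ^ 4 - (stepConst R κ - R ^ 2 - 2 * R - 1))) := fun ψ => by
    rw [← Real.exp_add, ← Finset.sum_neg_distrib, ← Finset.sum_neg_distrib,
      ← Finset.sum_add_distrib]
    congr 1
    exact Finset.sum_congr rfl fun x _ => by ring
  have hS : ∀ φ : Λ → ℝ, Real.exp (∑ x : {i // p i},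
      ((R ^ 2 + κ * boundaryInfluence J Λ η x) + κ * ∑ y : Λ, J x y * φ y ^ 2))
      = Real.exp (∑ _x : {i // p i}, R ^ 2) * Real.exp (∑ x : {i // p i},
            (κ * boundaryInfluence J Λ η x + ∑ y : Λ, κ * J x y * φ y ^ 2)) := fun φ => by
    rw [← Real.exp_add, ← Finset.sum_add_distrib]
    congr 1
    refine Finset.sum_congr rfl fun x _ => ?_
    rw [Finset.mul_sum, add_assoc]
    simp_rw [mul_assoc]
  rw [hk, lintegral_smul_measure, lintegral_smul_measure,
    lintegral_withDensity_eq_lintegral_mul _ (by fun_prop) hf',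
    lintegral_withDensity_eq_lintegral_mul _ (by fun_prop) (by fun_prop)]
  simp only [smul_eq_mul, Pi.mul_apply]
  rw [mul_left_comm]
  refine mul_le_mul' le_rfl ?_
  simp_rw [hI, ENNReal.ofReal_mul (Real.exp_pos _).le]
  simp_rw [hS, ENNReal.ofReal_mul (Real.exp_pos _).le,
    mul_assoc (ENNReal.ofReal _)] at key
  rw [lintegral_const_mul _ (by fun_prop)] at key
  simp_rw [mul_left_comm (f _)]
  rw [lintegral_const_mul _ (by fun_prop)]
  simp_rw [mul_comm (ENNReal.ofReal (Real.exp (phi4Exponent _ _ _ _ _ _)))]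
  refine key.trans_eq ?_
  rw [mul_left_comm, mul_assoc]

lemma lintegral_exp_sum_sq_le (P : ParameterBound R g a J β h η) {κ : ℝ} (hκ : 0 < κ) (Λ : Finset V)
    (B : Finset Λ) :
    ∫⁻ φ, ENNReal.ofReal (Real.exp (∑ x ∈ B, φ x ^ 2)) ∂(phi4Measure g a J β h Λ η)
      ≤ ENNReal.ofReal (Real.exp (∑ x ∈ B, (stepConst R κ + κ * boundaryInfluence J Λ η x)))
        * ∫⁻ φ, ENNReal.ofReal (Real.exp (∑ x ∈ B, ∑ y : Λ, κ * J x y * φ y ^ 2))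
              ∂(phi4Measure g a J β h Λ η) := by
  classical
  have key := P.lintegral_restrict_le hκ Λ (· ∈ B)
    (f := fun ψ => ENNReal.ofReal (Real.exp (∑ x, ψ x ^ 2))) (by fun_prop)
  -- Two `Fintype` instances on the subtype of members of `B` have to be identified.
  rw [Subsingleton.elim (Subtype.fintype (· ∈ B)) (Finset.Subtype.fintype B)] at key
  have hsub : ∀ F : Λ → ℝ, ∑ x : {i // i ∈ B}, F x = ∑ x ∈ B, F x := fun F =>
    Finset.sum_coe_sort B F
  set C := stepConst R κ - 2 * R - 1
  have hI : ∫⁻ ψ : {i // i ∈ B} → ℝ, ENNReal.ofReal (Real.exp (∑ x, ψ x ^ 2))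
      * ENNReal.ofReal (Real.exp (-∑ x, (g / 2 * ψ x ^ 4 - C)))
      ≤ ENNReal.ofReal (Real.exp (∑ _x ∈ B, stepConst R κ)) := by
    refine (lintegral_exp_sum_sq_mul_quartic_le P.g_pos P.one_le_mul).trans_eq ?_
    rw [Finset.sum_coe_sort B (fun _ => C + 2 * R + 1)]
    congr 3
    funext x
    simp only [C]
    ring
  have hsub1 : ∑ x : {i // i ∈ B}, κ * boundaryInfluence J Λ η x
      = ∑ x ∈ B, κ * boundaryInfluence J Λ η x := hsub fun x => κ * boundaryInfluence J Λ η x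
  have hsub2 : ∀ φ : Λ → ℝ, ∑ x : {i // i ∈ B}, ∑ y : Λ, κ * J x y * φ y ^ 2
      = ∑ x ∈ B, ∑ y : Λ, κ * J x y * φ y ^ 2 := fun φ =>
    hsub fun x => ∑ y : Λ, κ * J x y * φ y ^ 2
  have hsub3 : ∀ φ : Λ → ℝ, ∑ x : {i // i ∈ B}, φ x ^ 2 = ∑ x ∈ B, φ x ^ 2 := fun φ =>
    hsub fun x => φ x ^ 2
  simp only [Finset.sum_add_distrib, hsub1, hsub2, hsub3, Real.exp_add,
    ENNReal.ofReal_mul (Real.exp_pos _).le] at key ⊢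
  rw [lintegral_const_mul _ (by fun_prop), ← mul_assoc] at key
  exact key.trans (mul_le_mul' (mul_le_mul' hI le_rfl) le_rfl)

end ParameterBound

end FiniteVolume

/-- Setwise domination by a measure with density yields both absolute continuity and the almost
everywhere bound on the derivative. -/
lemma hasQuarticDensityBound_of_forall_le {V : Type*} {Δ : Finset V} {γ δ : ℝ}
    {μ : Measure (Δ → ℝ)}
    (hle : ∀ S, MeasurableSet S → μ S ≤ ∫⁻ ψ in S,
      ENNReal.ofReal (Real.exp (-∑ x : Δ, (γ * ψ x ^ 4 - δ)))) :
    HasQuarticDensityBound γ δ μ := by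
  set D : (Δ → ℝ) → ℝ≥0∞ := fun ψ => ENNReal.ofReal (Real.exp (-∑ x : Δ, (γ * ψ x ^ 4 - δ)))
  have hμ : μ ≤ volume.withDensity D := Measure.le_iff.2 fun S hS => by
    rw [withDensity_apply _ hS]; exact hle S hS
  refine ⟨(Measure.absolutelyContinuous_of_le hμ).trans (withDensity_absolutelyContinuous _ _), ?_⟩
  refine ae_le_of_forall_setLIntegral_le_of_sigmaFinite (Measure.measurable_rnDeriv _ _)
    fun S hS _ => ?_
  exact (Measure.setLIntegral_rnDeriv_le S).trans (hle S hS)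

/-! ### From moment bounds to density bounds -/

namespace ParameterBound

variable {V : Type*} {R g a β : ℝ} {J : V → V → ℝ} {h η : V → ℝ}

/-- The finiteness that starts the iteration. Its size is irrelevant, so κ = 1 will do. -/
lemma lintegral_exp_sum_sq_ne_top (P : ParameterBound R g a J β h η) (Λ : Finset V) :
    ∫⁻ φ, ENNReal.ofReal (Real.exp (∑ x, φ x ^ 2)) ∂(phi4Measure g a J β h Λ η) ≠ ∞ := by
  obtain ⟨k, hktop, hk⟩ := exists_phi4Measure_eq_smul g a J β h Λ η
  have hm := measurable_phi4Exponent g a β (fun x y : Λ => J x y) (effectiveField J h Λ η)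
  rw [hk, lintegral_smul_measure,
    lintegral_withDensity_eq_lintegral_mul _ (by fun_prop) (by fun_prop)]
  simp only [Pi.mul_apply, smul_eq_mul]
  refine ENNReal.mul_ne_top hktop ?_
  have hup := phi4Exponent_le (a := a) P.g_pos P.β_nonneg (fun x y : Λ => P.nonneg x y)
    (fun x y => P.symm x y) (fun x => P.sum_le Λ x)
    (fun x t => P.mul_effectiveField_le one_pos Λ x t)
  set C := (|a| + β * R + (R ^ 2 + R ^ 3 / (4 * 1))) ^ 2 / (2 * g)
  set T := ∑ x : Λ, (R ^ 2 + 1 * boundaryInfluence J Λ η x)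
  refine ne_top_of_le_ne_top ?_ (lintegral_mono (g := fun φ : Λ → ℝ => ENNReal.ofReal (Real.exp T)
    * (ENNReal.ofReal (Real.exp (∑ x, φ x ^ 2))
      * ENNReal.ofReal (Real.exp (-∑ x, (g / 2 * φ x ^ 4 - C))))) fun φ => ?_)
  · rw [lintegral_const_mul _ (by fun_prop)]
    exact ENNReal.mul_ne_top ENNReal.ofReal_ne_top (ne_top_of_le_ne_top ENNReal.ofReal_ne_top
      (lintegral_exp_sum_sq_mul_quartic_le P.g_pos P.one_le_mul))
  · simp only
    rw [← ENNReal.ofReal_mul (Real.exp_pos _).le, ← ENNReal.ofReal_mul (Real.exp_pos _).le,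
      ← ENNReal.ofReal_mul (Real.exp_pos _).le, ← Real.exp_add, ← Real.exp_add, ← Real.exp_add]
    refine ENNReal.ofReal_le_ofReal (Real.exp_le_exp.2 ?_)
    have := hup φ
    linarith

lemma sum_mul_le_half (P : ParameterBound R g a J β h η) {κ : ℝ} (hκ : 0 < κ) (hκR : κ * R ≤ 1 / 2)
    (Λ : Finset V) (y : Λ) : ∑ x : Λ, κ * J x y ≤ 1 / 2 := by
  rw [← Finset.mul_sum]
  simp_rw [P.symm _ y]
  exact (mul_le_mul_of_nonneg_left (P.sum_le Λ y) hκ.le).trans hκR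

lemma lintegral_exp_le_of_supersolution (P : ParameterBound R g a J β h η) {κ : ℝ} (hκ : 0 < κ)
    (hκR : κ * R ≤ 1 / 2) {Λ : Finset V} {v : V → ℝ} (hv0 : ∀ x, 0 ≤ v x)
    (hv : ∀ x : Λ, stepConst R κ + κ * boundaryInfluence J Λ η x + ∑ y : Λ, κ * J x y * v y ≤ v x)
    (B : Finset Λ) :
    ∫⁻ φ, ENNReal.ofReal (Real.exp (∑ x ∈ B, φ x ^ 2)) ∂(phi4Measure g a J β h Λ η)
      ≤ ENNReal.ofReal (Real.exp (∑ x ∈ B, v x)) :=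
  lintegral_exp_sum_le_of_supersolution (X := fun (x : Λ) (φ : Λ → ℝ) => φ x ^ 2)
    (q := fun x y => κ * J x y) (v := fun x : Λ => v x)
    (r := fun x => stepConst R κ + κ * boundaryInfluence J Λ η x)
    (phi4Measure_univ_le_one _ _ _ _ _ _ _) (fun x => by fun_prop) (fun x φ => sq_nonneg _)
    (fun x y => mul_nonneg hκ.le (P.nonneg _ _)) (P.sum_mul_le_half hκ hκR Λ)
    (P.lintegral_exp_sum_sq_le hκ Λ) (fun x => hv0 x) hv (P.lintegral_exp_sum_sq_ne_top Λ) B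

/-- The recursion without excess constant. Applied with κ free of the decay constant, it improves a
bound already obtained with another κ. -/
lemma lintegral_exp_le_step (P : ParameterBound R g a J β h η) {κ : ℝ} (hκ : 0 < κ)
    (hκR : κ * R ≤ 1 / 2) {Λ : Finset V} {v v' : V → ℝ}
    (hv : ∀ x : Λ, stepConst R κ + κ * boundaryInfluence J Λ η x + ∑ y : Λ, κ * J x y * v y ≤ v' x)
    (H : ∀ B : Finset Λ, ∫⁻ φ, ENNReal.ofReal (Real.exp (∑ x ∈ B, φ x ^ 2))
        ∂(phi4Measure g a J β h Λ η) ≤ ENNReal.ofReal (Real.exp (∑ x ∈ B, v x)))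
    (B : Finset Λ) :
    ∫⁻ φ, ENNReal.ofReal (Real.exp (∑ x ∈ B, φ x ^ 2)) ∂(phi4Measure g a J β h Λ η)
      ≤ ENNReal.ofReal (Real.exp (∑ x ∈ B, v' x)) := by
  have := lintegral_exp_sum_le_step (K := 0) (X := fun (x : Λ) (φ : Λ → ℝ) => φ x ^ 2)
    (q := fun x y => κ * J x y) (v := fun x : Λ => v x) (v' := fun x : Λ => v' x)
    (r := fun x => stepConst R κ + κ * boundaryInfluence J Λ η x)
    (phi4Measure_univ_le_one _ _ _ _ _ _ _) (fun x => by fun_prop)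
    (fun x y => mul_nonneg hκ.le (P.nonneg _ _)) (P.sum_mul_le_half hκ hκR Λ)
    (P.lintegral_exp_sum_sq_le hκ Λ) hv (by simpa using H) B
  simpa using this

/-- Exponential moment bounds turn into density bounds for the projections. -/
lemma map_restrict₂_le (P : ParameterBound R g a J β h η) {κ c : ℝ} (hκ : 0 < κ)
    (hκR : κ * R ≤ 1 / 2) {Λ Δ : Finset V} (hΔΛ : Δ ⊆ Λ) {v : V → ℝ}
    (hv : ∀ x ∈ Δ,
      stepConst R κ + κ * boundaryInfluence J Λ η x + ∑ y : Λ, κ * J x y * v y ≤ c)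
    (H : ∀ B : Finset Λ, ∫⁻ φ, ENNReal.ofReal (Real.exp (∑ x ∈ B, φ x ^ 2))
        ∂(phi4Measure g a J β h Λ η) ≤ ENNReal.ofReal (Real.exp (∑ x ∈ B, v x)))
    {S : Set (Δ → ℝ)} (hS : MeasurableSet S) :
    (phi4Measure g a J β h Λ η).map (Finset.restrict₂ (π := fun _ => ℝ) hΔΛ) S
      ≤ ∫⁻ ψ in S, ENNReal.ofReal (Real.exp (-∑ x : Δ, (g / 2 * ψ x ^ 4 - c))) := by
  classical
  -- The inner spins are indexed by a subtype of `Λ`; `e` and `T` transport them to `Δ` without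
  -- changing volume.
  let p : Λ → Prop := fun x => x.1 ∈ Δ
  let e : {x : Λ // p x} ≃ Δ :=
    { toFun := fun x => ⟨x.1.1, x.2⟩
      invFun := fun x => ⟨⟨x.1, hΔΛ x.2⟩, x.2⟩
      left_inv := fun x => rfl
      right_inv := fun x => rfl }
  let T := MeasurableEquiv.piCongrLeft (fun _ : Δ => ℝ) e
  have hT : MeasurePreserving T volume volume :=
    volume_measurePreserving_piCongrLeft (fun _ : Δ => ℝ) e
  have hTe : ∀ (ψ : {x : Λ // p x} → ℝ) x, T ψ (e x) = ψ x := fun ψ x => by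
    simp only [T, MeasurableEquiv.coe_piCongrLeft]
    exact Equiv.piCongrLeft_apply_apply (fun _ : Δ => ℝ) e ψ x
  have hTr : ∀ φ : Λ → ℝ, T (fun i => φ i) = Finset.restrict₂ (π := fun _ => ℝ) hΔΛ φ := fun φ => by
    funext x
    obtain ⟨i, rfl⟩ := e.surjective x
    rw [hTe]
    rfl
  have hrm : Measurable (Finset.restrict₂ (π := fun _ : V => ℝ) hΔΛ) :=
    measurable_pi_lambda _ fun x => measurable_pi_apply _
  have key := P.lintegral_restrict_le hκ Λ p (f := fun ψ => S.indicator 1 (T ψ))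
    ((measurable_one.indicator hS).comp T.measurable)
  simp only [hTr] at key
  have hlhs : (phi4Measure g a J β h Λ η).map (Finset.restrict₂ (π := fun _ => ℝ) hΔΛ) S
      = ∫⁻ φ, S.indicator 1 (Finset.restrict₂ (π := fun _ => ℝ) hΔΛ φ)
        ∂(phi4Measure g a J β h Λ η) := by
    rw [Measure.map_apply hrm hS, ← lintegral_indicator_one (hrm hS)]
    rfl
  rw [hlhs]
  refine key.trans ?_
  set C := stepConst R κ - 2 * R - 1
  set b : V → ℝ := fun x => κ * boundaryInfluence J Λ η x
  have hsub : ∀ F : Λ → ℝ, ∑ x : {x // p x}, F x = ∑ x ∈ Finset.univ.filter p, F x := fun F =>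
    (Finset.sum_subtype _ (by simp) F).symm
  have hmom := lintegral_exp_sum_sum_mul_le (K := 0) (X := fun (x : Λ) (φ : Λ → ℝ) => φ x ^ 2)
    (q := fun x y => κ * J x y) (v := fun x : Λ => v x)
    (phi4Measure_univ_le_one g a J β h Λ η) (fun x => by fun_prop)
    (fun x y => mul_nonneg hκ.le (P.nonneg _ _)) (P.sum_mul_le_half hκ hκR Λ)
    (by simpa using H) (Finset.univ.filter p)
  simp only [zero_div, zero_add] at hmom
  have hsq : ∀ w : Λ → ℝ, ∑ x : {x // p x}, (b x + ∑ y : Λ, κ * J x y * w y)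
      = ∑ x : {x // p x}, b x + ∑ x ∈ Finset.univ.filter p, ∑ y : Λ, κ * J x y * w y := fun w => by
    rw [Finset.sum_add_distrib]
    congr 1
    exact hsub fun x => ∑ y : Λ, κ * J x y * w y
  have hE : ∫⁻ φ, ENNReal.ofReal (Real.exp (∑ x : {x // p x},
        (b x + ∑ y : Λ, κ * J x y * φ y ^ 2))) ∂(phi4Measure g a J β h Λ η)
      ≤ ENNReal.ofReal (Real.exp (∑ x : {x // p x}, (b x + ∑ y : Λ, κ * J x y * v y))) := by
    rw [hsq fun y => v y]
    have : ∀ φ : Λ → ℝ, ENNReal.ofReal (Real.exp (∑ x : {x // p x},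
        (b x + ∑ y : Λ, κ * J x y * φ y ^ 2))) = ENNReal.ofReal (Real.exp (∑ x : {x // p x}, b x))
        * ENNReal.ofReal (Real.exp (∑ x ∈ Finset.univ.filter p, ∑ y : Λ, κ * J x y * φ y ^ 2)) := by
      intro φ
      rw [hsq fun y => φ y ^ 2, Real.exp_add, ENNReal.ofReal_mul (Real.exp_pos _).le]
    simp_rw [this]
    rw [lintegral_const_mul _ (by fun_prop), Real.exp_add, ENNReal.ofReal_mul (Real.exp_pos _).le]
    exact mul_le_mul' le_rfl hmom
  refine (mul_le_mul' le_rfl hE).trans ?_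
  rw [← lintegral_indicator hS, ← hT.lintegral_comp
    ((show Measurable fun ψ : Δ → ℝ => ENNReal.ofReal
      (Real.exp (-∑ x : Δ, (g / 2 * ψ x ^ 4 - c))) by fun_prop).indicator hS),
    ← lintegral_mul_const _ (by
      exact ((measurable_one.indicator hS).comp T.measurable).mul (by fun_prop))]
  refine lintegral_mono fun ψ => ?_
  by_cases hψ : T ψ ∈ S
  · simp only [indicator_of_mem hψ, Pi.one_apply, one_mul]
    rw [← ENNReal.ofReal_mul (Real.exp_pos _).le, ← Real.exp_add]
    refine ENNReal.ofReal_le_ofReal (Real.exp_le_exp.2 ?_)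
    rw [← e.sum_comp, ← Finset.sum_neg_distrib, ← Finset.sum_neg_distrib, ← Finset.sum_add_distrib]
    refine Finset.sum_le_sum fun x _ => ?_
    rw [hTe]
    have h1 := hv x x.2
    have h2 := P.R_pos
    simp only [C, b]
    linarith
  · simp [hψ]

end ParameterBound

/-! ### Supersolutions built from the potential of the boundary condition -/

section BoundaryPotential

variable {V : Type*} {G : SimpleGraph V} {q S K R g a β : ℝ} {J : V → V → ℝ} {h η : V → ℝ}

/-- The potential at `x` of the squared boundary condition. -/
noncomputable def boundaryPotential (G : SimpleGraph V) (q : ℝ) (Λ : Finset V) (η : V → ℝ)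
    (x : V) : ℝ :=
  ∑' z, decayKernel G q x z * (Λ : Set V)ᶜ.indicator (fun z => η z ^ 2) z

lemma boundaryPotential_nonneg (Λ : Finset V) (x : V) : 0 ≤ boundaryPotential G q Λ η x :=
  tsum_nonneg fun _ => mul_nonneg (decayKernel_pos _ _ _).le
    (indicator_nonneg (fun _ _ => sq_nonneg _) _)

lemma summable_decayKernel_mul_indicator (hη : ∀ x, Summable fun z => decayKernel G q x z * η z ^ 2)
    (Λ : Finset V) (x : V) :
    Summable fun z => decayKernel G q x z * (Λ : Set V)ᶜ.indicator (fun z => η z ^ 2) z := by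
  refine (hη x).of_nonneg_of_le (fun z => mul_nonneg (decayKernel_pos _ _ _).le
    (indicator_nonneg (fun _ _ => sq_nonneg _) _)) fun z => ?_
  exact mul_le_mul_of_nonneg_left (indicator_le_self' (fun z _ => sq_nonneg _) z)
    (decayKernel_pos _ _ _).le

namespace ParameterBound

/-- The ansatz c + D u, with u the boundary potential, is stable under the recursion: row sums
multiply c by κR, and k∗k ≤ const · k returns a multiple of u. -/
lemma recursion_le (P : ParameterBound R g a J β h η) (hconn : G.Connected) (hq : 0 ≤ q)
    (hS : ∀ x, HasSum (decayKernel G q x) S) (hK : 0 ≤ K)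
    (hJK : ∀ x y, J x y ≤ K * decayKernel G q x y)
    (hη : ∀ x, Summable fun z => decayKernel G q x z * η z ^ 2)
    {κ c D : ℝ} (hκ : 0 < κ) (hc : 0 ≤ c) (hD : 0 ≤ D) (Λ : Finset V) (x : V) :
    κ * boundaryInfluence J Λ η x + ∑ y : Λ, κ * J x y * (c + D * boundaryPotential G q Λ η y)
      ≤ κ * R * c + κ * K * (1 + 2 ^ q * (2 * S) * D) * boundaryPotential G q Λ η x := by
  have hsum := summable_decayKernel_mul_indicator hη Λ
  have hind : ∀ z, 0 ≤ (Λ : Set V)ᶜ.indicator (fun z => η z ^ 2) z :=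
    fun z => indicator_nonneg (fun z _ => sq_nonneg _) z
  have h1 : boundaryInfluence J Λ η x ≤ K * boundaryPotential G q Λ η x := by
    have e : boundaryInfluence J Λ η x
        = ∑' z, J x z * (Λ : Set V)ᶜ.indicator (fun z => η z ^ 2) z := by
      have := tsum_subtype (Λ : Set V)ᶜ (fun z => J x z * η z ^ 2)
      rw [boundaryInfluence]
      refine Eq.trans this (tsum_congr fun z => ?_)
      by_cases hz : z ∈ (Λ : Set V)ᶜ <;> simp [hz]
    rw [e, boundaryPotential, ← tsum_mul_left]
    have hle : ∀ z, J x z * (Λ : Set V)ᶜ.indicator (fun z => η z ^ 2) z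
        ≤ K * (decayKernel G q x z * (Λ : Set V)ᶜ.indicator (fun z => η z ^ 2) z) := fun z => by
      rw [← mul_assoc]
      exact mul_le_mul_of_nonneg_right (hJK x z) (hind z)
    exact Summable.tsum_le_tsum hle (((hsum x).mul_left K).of_nonneg_of_le
      (fun z => mul_nonneg (P.nonneg _ _) (hind z)) hle) ((hsum x).mul_left K)
  have h2 : ∑ y : Λ, J x y * boundaryPotential G q Λ η y
      ≤ K * (2 ^ q * (2 * S) * boundaryPotential G q Λ η x) := by
    rw [Finset.sum_coe_sort Λ (fun y => J x y * boundaryPotential G q Λ η y)]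
    calc ∑ y ∈ Λ, J x y * boundaryPotential G q Λ η y
        ≤ ∑ y ∈ Λ, K * (decayKernel G q x y * boundaryPotential G q Λ η y) := by
          refine Finset.sum_le_sum fun y _ => ?_
          rw [← mul_assoc]
          exact mul_le_mul_of_nonneg_right (hJK x y) (boundaryPotential_nonneg Λ y)
      _ ≤ _ := by
          rw [← Finset.mul_sum]
          exact mul_le_mul_of_nonneg_left
            (sum_decayKernel_mul_tsum_le hconn hq hS hind hsum Λ x) hK
  have h3 : ∑ y : Λ, κ * J x y * (c + D * boundaryPotential G q Λ η y)
      = κ * (∑ y : Λ, J x y) * c + κ * D * ∑ y : Λ, J x y * boundaryPotential G q Λ η y := by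
    rw [Finset.mul_sum, Finset.sum_mul, Finset.mul_sum, ← Finset.sum_add_distrib]
    exact Finset.sum_congr rfl fun y _ => by ring
  have h4 : κ * (∑ y : Λ, J x y) * c ≤ κ * R * c :=
    mul_le_mul_of_nonneg_right (mul_le_mul_of_nonneg_left (P.sum_le Λ x) hκ.le) hc
  have h5 := mul_le_mul_of_nonneg_left h1 hκ.le
  have h6 := mul_le_mul_of_nonneg_left h2 (mul_nonneg hκ.le hD)
  rw [h3]
  linarith

/-- The influence parameter for which the kernel yields a supersolution. -/
noncomputable def _root_.supersolutionInfluence (q S R K : ℝ) : ℝ :=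
  1 / (2 * R + K * (1 + 2 ^ q * (2 * S)))

lemma supersolution (P : ParameterBound R g a J β h η) (hconn : G.Connected) (hq : 0 ≤ q)
    (hS0 : 0 ≤ S) (hS : ∀ x, HasSum (decayKernel G q x) S) (hK : 0 ≤ K)
    (hJK : ∀ x y, J x y ≤ K * decayKernel G q x y)
    (hη : ∀ x, Summable fun z => decayKernel G q x z * η z ^ 2) (Λ : Finset V) :
    let κ := supersolutionInfluence q S R K
    0 < κ ∧ κ * R ≤ 1 / 2 ∧
    (∀ x, stepConst R κ + κ * boundaryInfluence J Λ η x
      + ∑ y : Λ, κ * J x y * (2 * stepConst R κ + boundaryPotential G q Λ η y)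
        ≤ 2 * stepConst R κ + boundaryPotential G q Λ η x) ∧
    ∀ B : Finset Λ, ∫⁻ φ, ENNReal.ofReal (Real.exp (∑ x ∈ B, φ x ^ 2))
        ∂(phi4Measure g a J β h Λ η) ≤ ENNReal.ofReal (Real.exp
          (∑ x ∈ B, (2 * stepConst R κ + boundaryPotential G q Λ η x))) := by
  intro κ
  have hR := P.R_pos
  have hB : 0 ≤ K * (1 + 2 ^ q * (2 * S)) := by positivity
  have hden : 0 < 2 * R + K * (1 + 2 ^ q * (2 * S)) := by positivity
  have hκ : 0 < κ := by simp only [κ, supersolutionInfluence]; positivity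
  -- This identity gives both κR ≤ 1/2 and κK(1 + 2^q · 2S) ≤ 1. The first makes 2 `stepConst` a
  -- supersolution for the constant part, the second reproduces the potential with coefficient 1.
  have hκe : κ * (2 * R + K * (1 + 2 ^ q * (2 * S))) = 1 := by
    simp only [κ, supersolutionInfluence]; field_simp
  have hκB := mul_nonneg hκ.le hB
  have hκR' := mul_pos hκ hR
  have hκR : κ * R ≤ 1 / 2 := by linarith
  have hC := stepConst_pos hR hκ
  have hrec : ∀ x, stepConst R κ + κ * boundaryInfluence J Λ η x
      + ∑ y : Λ, κ * J x y * (2 * stepConst R κ + boundaryPotential G q Λ η y)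
        ≤ 2 * stepConst R κ + boundaryPotential G q Λ η x := fun x => by
    have := P.recursion_le hconn hq hS hK hJK hη hκ (c := 2 * stepConst R κ) (D := 1)
      (by positivity) zero_le_one Λ x
    simp only [one_mul, mul_one] at this
    have hu := boundaryPotential_nonneg (G := G) (q := q) (η := η) Λ x
    have h1 : κ * R * (2 * stepConst R κ) ≤ 1 / 2 * (2 * stepConst R κ) :=
      mul_le_mul_of_nonneg_right hκR (by positivity)
    have h2 : κ * K * (1 + 2 ^ q * (2 * S)) * boundaryPotential G q Λ η x
        ≤ 1 * boundaryPotential G q Λ η x :=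
      mul_le_mul_of_nonneg_right (by linarith) hu
    linarith
  refine ⟨hκ, hκR, hrec, fun B => ?_⟩
  exact P.lintegral_exp_le_of_supersolution hκ hκR
    (v := fun x => 2 * stepConst R κ + boundaryPotential G q Λ η x)
    (fun x => add_nonneg (by positivity) (boundaryPotential_nonneg Λ x)) (fun x => hrec x) B

/-- Density bound with a constant depending on the decay of the interaction. -/
lemma map_restrict₂_le_of_boundaryPotential_le (P : ParameterBound R g a J β h η)
    (hconn : G.Connected) (hq : 0 ≤ q)
    (hS0 : 0 ≤ S) (hS : ∀ x, HasSum (decayKernel G q x) S) (hK : 0 ≤ K)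
    (hJK : ∀ x y, J x y ≤ K * decayKernel G q x y)
    (hη : ∀ x, Summable fun z => decayKernel G q x z * η z ^ 2) {Λ Δ : Finset V} (hΔΛ : Δ ⊆ Λ)
    {U : ℝ} (hU : ∀ x ∈ Δ, boundaryPotential G q Λ η x ≤ U) {A : Set (Δ → ℝ)}
    (hA : MeasurableSet A) :
    (phi4Measure g a J β h Λ η).map (Finset.restrict₂ (π := fun _ => ℝ) hΔΛ) A
      ≤ ∫⁻ ψ in A, ENNReal.ofReal (Real.exp (-∑ x : Δ, (g / 2 * ψ x ^ 4
          - (2 * stepConst R (supersolutionInfluence q S R K) + U)))) := by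
  obtain ⟨hκ, hκR, hrec, H⟩ := P.supersolution hconn hq hS0 hS hK hJK hη Λ
  exact P.map_restrict₂_le hκ hκR hΔΛ
    (v := fun x => 2 * stepConst R (supersolutionInfluence q S R K) + boundaryPotential G q Λ η x)
    (fun x hx => (hrec x).trans (by linarith [hU x hx])) H hA

end ParameterBound

/-- Density bound with a constant depending on the interaction only through its row sums, valid when
the boundary condition has a small enough potential. -/
lemma exists_map_restrict₂_le_of_boundaryPotential_le (hconn : G.Connected) (hq : 0 ≤ q)
    (hS0 : 0 ≤ S) (hS : ∀ x, HasSum (decayKernel G q x) S) (hK : 0 ≤ K)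
    (hJK : ∀ x y, J x y ≤ K * decayKernel G q x y) (hR : 0 < R) :
    ∃ D : ℝ, 0 < D ∧ ∀ η : V → ℝ, ParameterBound R g a J β h η →
      (∀ x, Summable fun z => decayKernel G q x z * η z ^ 2) →
      ∀ (Λ Δ : Finset V) (hΔΛ : Δ ⊆ Λ), (∀ x ∈ Δ, D * boundaryPotential G q Λ η x ≤ 1) →
      ∀ A : Set (Δ → ℝ), MeasurableSet A →
        (phi4Measure g a J β h Λ η).map (Finset.restrict₂ (π := fun _ => ℝ) hΔΛ) A
          ≤ ∫⁻ ψ in A, ENNReal.ofReal (Real.exp (-∑ x : Δ, (g / 2 * ψ x ^ 4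
              - (2 * stepConst R (1 / (2 * R)) + 2)))) := by
  -- This κ no longer sees the decay constant `K`, which survives only in the starting constant `c₀`
  -- and in the coefficients `D k`.
  set κ := 1 / (2 * R)
  have hκ : 0 < κ := by positivity
  have hκR : κ * R = 1 / 2 := by simp only [κ]; field_simp
  set c₀ := 2 * stepConst R (supersolutionInfluence q S R K)
  have hc₀ : 0 < c₀ := mul_pos two_pos
    (stepConst_pos hR (by unfold supersolutionInfluence; positivity))
  have hC := stepConst_pos hR hκ
  set B := 2 ^ q * (2 * S)
  have hB : 0 ≤ B := by positivity
  let D : ℕ → ℝ := fun k => (fun D => κ * K * (1 + B * D))^[k] 1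
  have hDs : ∀ k, D (k + 1) = κ * K * (1 + B * D k) := fun k => by
    simp only [D, Function.iterate_succ_apply']
  have hD0 : ∀ k, 0 ≤ D k := fun k => by
    induction k with
    | zero => simp [D]
    | succ k ih => rw [hDs]; positivity
  -- The constant part solves c ↦ `stepConst` + c/2; its fixed point is 2 `stepConst`, and the
  -- dependence on `c₀` decays geometrically.
  let c : ℕ → ℝ := fun k => 2 * stepConst R κ + (1 / 2) ^ k * c₀
  have hc : ∀ k, 0 ≤ c k := fun k => by positivity
  have hrec : ∀ η : V → ℝ, ParameterBound R g a J β h η →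
      (∀ x, Summable fun z => decayKernel G q x z * η z ^ 2) → ∀ (Λ : Finset V) k x,
      stepConst R κ + κ * boundaryInfluence J Λ η x
        + ∑ y : Λ, κ * J x y * (c k + D k * boundaryPotential G q Λ η y)
      ≤ c (k + 1) + D (k + 1) * boundaryPotential G q Λ η x := by
    intro η P hη Λ k x
    have := P.recursion_le hconn hq hS hK hJK hη hκ (hc k) (hD0 k) Λ x
    rw [hκR] at this
    rw [hDs]
    have e : c (k + 1) = stepConst R κ + 1 / 2 * c k := by simp only [c, pow_succ]; ring
    linarith
  obtain ⟨k, hk⟩ : ∃ k : ℕ, (1 / 2 : ℝ) ^ k < 1 / c₀ :=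
    exists_pow_lt_of_lt_one (by positivity) (by norm_num)
  have hk' : (1 / 2 : ℝ) ^ (k + 1) * c₀ ≤ 1 := by
    rw [lt_div_iff₀ hc₀] at hk
    rw [pow_succ]
    have : 0 ≤ (1 / 2 : ℝ) ^ k * c₀ := by positivity
    linarith
  -- The added 1 ensures positivity. In the final constant, one unit covers the remainder of `c₀`
  -- and one the potential.
  refine ⟨D (k + 1) + 1, by linarith [hD0 (k + 1)], fun η P hη Λ Δ hΔΛ hΔ A hA => ?_⟩
  have H : ∀ k, ∀ B : Finset Λ, ∫⁻ φ, ENNReal.ofReal (Real.exp (∑ x ∈ B, φ x ^ 2))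
      ∂(phi4Measure g a J β h Λ η) ≤ ENNReal.ofReal (Real.exp
        (∑ x ∈ B, (c k + D k * boundaryPotential G q Λ η x))) := by
    intro k
    induction k with
    | zero =>
      intro B
      refine ((P.supersolution hconn hq hS0 hS hK hJK hη Λ).2.2.2 B).trans
        (ENNReal.ofReal_le_ofReal (Real.exp_le_exp.2 (Finset.sum_le_sum fun x _ => ?_)))
      simp only [c, D, pow_zero, one_mul, Function.iterate_zero, id]
      linarith
    | succ k ih =>
      exact P.lintegral_exp_le_step hκ hκR.le
        (v := fun x => c k + D k * boundaryPotential G q Λ η x)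
        (v' := fun x => c (k + 1) + D (k + 1) * boundaryPotential G q Λ η x)
        (fun x => hrec η P hη Λ k x) ih
  refine P.map_restrict₂_le hκ hκR.le hΔΛ (v := fun x => c k + D k * boundaryPotential G q Λ η x)
    (fun x hx => (hrec η P hη Λ k x).trans ?_) (H k) hA
  have h1 := hΔ x hx
  have h2 := boundaryPotential_nonneg (G := G) (q := q) (η := η) Λ x
  have h3 : c (k + 1) ≤ 2 * stepConst R κ + 1 := by simp only [c]; linarith
  linarith

/-- Boundary conditions may be set to 0 inside `Λ`, so assumptions on them outside `Λ` yield
summability over all of `V`. -/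
lemma phi4Measure_indicator_compl (g a : ℝ) (J : V → V → ℝ) (β : ℝ) (h : V → ℝ) (Λ : Finset V)
    (η : V → ℝ) :
    phi4Measure g a J β h Λ ((Λ : Set V)ᶜ.indicator η) = phi4Measure g a J β h Λ η := by
  have : ∀ y : {y : V // y ∉ Λ}, (Λ : Set V)ᶜ.indicator η y = η y := fun y =>
    indicator_of_mem (by simp) η
  simp only [phi4Measure, hamiltonian, this]

end BoundaryPotential

/-! ### Row sums and decay of admissible interactions -/

section Parameters

variable {V : Type*} {G : SimpleGraph V} {o : V} {d : ℝ}

lemma ContinuousOn.stepConst {X : Type*} [TopologicalSpace X] {s : Set X} {R κ : X → ℝ}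
    (hR : ContinuousOn R s) (hκ : ContinuousOn κ s) (h : ∀ x ∈ s, 0 < κ x) :
    ContinuousOn (fun x => stepConst (R x) (κ x)) s := by
  have h4 : ∀ x ∈ s, 4 * κ x ≠ 0 := fun x hx => by have := h x hx; positivity
  have h1 : ContinuousOn (fun x => R x ^ 3 / (4 * κ x)) s :=
    (hR.pow 3).div (continuousOn_const.mul hκ) h4
  have h2 : ContinuousOn (fun x => R x ^ 2 * R x / (4 * κ x)) s :=
    ((hR.pow 2).mul hR).div (continuousOn_const.mul hκ) h4
  unfold _root_.stepConst
  fun_prop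

/-- The sum of the couplings of the vertex `o`. -/
noncomputable def rowSum (o : V) (J : AdmissibleInteraction G d) : ℝ := ∑' y, J.coupling o y

namespace AdmissibleInteraction

lemma nonneg (J : AdmissibleInteraction G d) (x y : V) : 0 ≤ J.coupling x y :=
  let ⟨_, _, h⟩ := J.admissible
  h.ferromagnetic x y

lemma symm (J : AdmissibleInteraction G d) (x y : V) : J.coupling x y = J.coupling y x :=
  let ⟨_, _, h⟩ := J.admissible
  h.symm x y

/-- Admissibility says nothing about decay on the diagonal, where J is constant by transitivity;
that value enters the maximum. -/
lemma exists_le_decayKernel (o : V) (hconn : G.Connected) (J : AdmissibleInteraction G d) :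
    ∃ K ε : ℝ, 0 ≤ K ∧ 0 < ε ∧ ∀ x y, J.coupling x y ≤ K * decayKernel G (d + ε) x y := by
  obtain ⟨Γ, hΓ, hJ⟩ := J.admissible
  obtain ⟨C, ε, hC, hε, h⟩ := hJ.integrable
  refine ⟨max C (J.coupling o o), ε, hC.le.trans (le_max_left _ _), hε, fun x y => ?_⟩
  by_cases hxy : x = y
  · subst hxy
    obtain ⟨γ, hγ, rfl⟩ := hΓ o x
    rw [hJ.invariant γ hγ]
    simp [decayKernel]
  · have h1 : (1 : ℝ) ≤ G.dist x y := by exact_mod_cast hconn.pos_dist_of_ne hxy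
    refine (h x y hxy).trans ?_
    rw [decayKernel, max_eq_left h1]
    exact mul_le_mul_of_nonneg_right (le_max_left _ _) (by positivity)

lemma summable (hconn : G.Connected) (htrans : ∀ x y : V, ∃ γ : G ≃g G, γ x = y) (hd : 0 ≤ d)
    (hgrowth : HasPolynomialGrowth G o d) (J : AdmissibleInteraction G d) (x : V) :
    Summable (J.coupling x) := by
  obtain ⟨K, ε, -, hε, h⟩ := J.exists_le_decayKernel o hconn
  obtain ⟨S, -, hS⟩ := exists_hasSum_decayKernel hconn htrans hd hgrowth hε
  exact ((hS x).summable.mul_left K).of_nonneg_of_le (fun y => J.nonneg x y) (h x)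

lemma tsum_eq_rowSum (J : AdmissibleInteraction G d) (x : V) : ∑' y, J.coupling x y = rowSum o J := by
  obtain ⟨Γ, hΓ, hJ⟩ := J.admissible
  obtain ⟨γ, hγ, rfl⟩ := hΓ o x
  rw [rowSum, ← γ.toEquiv.tsum_eq]
  exact tsum_congr fun y => hJ.invariant γ hγ o y

lemma rowSum_nonneg (J : AdmissibleInteraction G d) : 0 ≤ rowSum o J :=
  tsum_nonneg fun y => J.nonneg o y

/-- The row sum at `o` is 1-Lipschitz, since its variation is controlled by the term x = o of the
supremum defining the distance. -/
lemma continuous_rowSum (hconn : G.Connected) (htrans : ∀ x y : V, ∃ γ : G ≃g G, γ x = y)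
    (hd : 0 ≤ d) (hgrowth : HasPolynomialGrowth G o d) :
    Continuous (rowSum o : AdmissibleInteraction G d → ℝ) := by
  refine LipschitzWith.continuous (K := 1) fun J J' => ?_
  rw [ENNReal.coe_one, one_mul, edist_eq_enorm_sub, rowSum, rowSum,
    ← (J.summable hconn htrans hd hgrowth o).tsum_sub (J'.summable hconn htrans hd hgrowth o)]
  exact enorm_tsum_le_tsum_enorm.trans
    (le_iSup (fun x => ∑' y, ‖J.coupling x y - J'.coupling x y‖ₑ) o)

end AdmissibleInteraction

lemma one_le_mul_of_inv_le {g R : ℝ} (hg : 0 < g) (h : g⁻¹ ≤ R) : 1 ≤ R * g := by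
  have := mul_le_mul_of_nonneg_right h hg.le
  rwa [inv_mul_cancel₀ hg.ne'] at this

lemma summable_decayKernel_mul_of_base (hconn : G.Connected) {q : ℝ} (hq : 0 ≤ q) {b : V → ℝ}
    (hb : ∀ x, 0 ≤ b x) (h : Summable fun z => decayKernel G q o z * b z) (x : V) :
    Summable fun z => decayKernel G q x z * b z :=
  (h.mul_left ((1 + G.dist o x : ℝ) ^ q)).of_nonneg_of_le
    (fun z => mul_nonneg (decayKernel_pos _ _ _).le (hb z)) fun z => by
      rw [← mul_assoc]
      exact mul_le_mul_of_nonneg_right (decayKernel_le_mul hconn hq x z) (hb z)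

lemma countable_of_finite_graphBall (hfin : ∀ k, (graphBall G o k).Finite) : Countable V := by
  rw [← Set.countable_univ_iff]
  refine (Set.countable_iUnion fun k => (hfin k).countable).mono fun x _ => ?_
  exact mem_iUnion.2 ⟨G.dist o x, le_refl (G.dist o x)⟩

end Parameters

/-! ### Gibbs measures: the infinite-volume limit -/

section GibbsMeasures

variable {V : Type*} {G : SimpleGraph V} {o : V} {d : ℝ}

/-- Projections of Gibbs measures are dominated by a quartic density: apply the DLR equations in large
balls, where the boundary condition has a small potential at fixed sites. -/
lemma map_restrict_le_of_isGibbs (hconn : G.Connected)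
    (htrans : ∀ x y : V, ∃ γ : G ≃g G, γ x = y) (hd : 0 ≤ d) (hgrowth : HasPolynomialGrowth G o d)
    {R g a β : ℝ} {J : AdmissibleInteraction G d} {h : V → ℝ}
    (P : ∀ η : V → ℝ, (∀ x, Summable fun y => J.coupling x y * η y ^ 2) →
      ParameterBound R g a J.coupling β h η) (hR : 0 < R)
    {ν : Measure (V → ℝ)} (hν : IsGibbs G o g a J.coupling β h ν) (Δ : Finset V)
    {A : Set (Δ → ℝ)} (hA : MeasurableSet A) :
    ν.map Δ.restrict A ≤ ∫⁻ ψ in A, ENNReal.ofReal (Real.exp (-∑ x : Δ, (g / 2 * ψ x ^ 4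
      - (2 * stepConst R (1 / (2 * R)) + 2)))) := by
  classical
  have hprob := hν.isProbabilityMeasure
  have hfin := finite_graphBall hgrowth
  have hcount := countable_of_finite_graphBall hfin
  obtain ⟨K, ε, hK, hε, hJK⟩ := J.exists_le_decayKernel o hconn
  have hq : 0 ≤ d + ε := by positivity
  set q := d + ε with hqdef
  obtain ⟨S, hS0, hS⟩ := exists_hasSum_decayKernel hconn htrans hd hgrowth hε
  obtain ⟨D, hD, hbound⟩ := exists_map_restrict₂_le_of_boundaryPotential_le (g := g) (a := a)
    (β := β) (h := h) hconn hq hS0.le hS hK hJK hR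
  set I := ∫⁻ ψ in A, ENNReal.ofReal (Real.exp (-∑ x : Δ, (g / 2 * ψ x ^ 4
      - (2 * stepConst R (1 / (2 * R)) + 2))))
  let Λ : ℕ → Finset V := fun n => (hfin n).toFinset
  have hΛmem : ∀ n x, x ∈ Λ n ↔ G.dist o x ≤ n := fun n x => by
    simp [Λ, graphBall]
  have hΛmono : Monotone Λ := fun m n hmn x hx => by
    rw [hΛmem] at hx ⊢; omega
  let W : (V → ℝ) → V → ℝ≥0∞ := fun η z => ENNReal.ofReal (decayKernel G q o z * η z ^ 2)
  let e : ℕ → (V → ℝ) → ℝ≥0∞ := fun n η => ∑' z : {z // z ∉ Λ n}, W η z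
  have hem : ∀ n, Measurable (e n) := fun n =>
    Measurable.tsum fun z => by simp only [W]; fun_prop
  -- the potentials of a typical boundary condition vanish in the limit
  have hlim : ∀ᵐ η ∂ν, Filter.Tendsto (fun n => e n η) Filter.atTop (nhds 0) := by
    filter_upwards [hν.tempered.growth] with η hη
    obtain ⟨C, hC, hgr⟩ := hη
    obtain ⟨c', C', -, hC', hball⟩ := hgrowth
    have hsum : Summable fun z => decayKernel G q o z * η z ^ 2 :=
      summable_decayKernel_mul hfin hd hε (fun x => sq_nonneg _) (C := C * C') fun k hk => by
        refine (hgr k).trans ?_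
        rw [mul_assoc]
        exact mul_le_mul_of_nonneg_left (hball k hk).2 hC.le
    have htop : ∑' z, W η z ≠ ∞ := by
      simp only [W]
      rw [← ENNReal.ofReal_tsum_of_nonneg
        (fun z => mul_nonneg (decayKernel_pos _ _ _).le (sq_nonneg _)) hsum]
      exact ENNReal.ofReal_ne_top
    exact (ENNReal.tendsto_tsum_compl_atTop_zero htop).comp
      (Filter.tendsto_atTop_finset_of_monotone hΛmono fun x => ⟨G.dist o x, by simp [hΛmem]⟩)
  obtain ⟨m, hm⟩ : ∃ m : ℕ, ∀ x ∈ Δ, G.dist o x ≤ m :=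
    ⟨Δ.sup (G.dist o), fun x hx => Finset.le_sup (f := G.dist o) hx⟩
  -- Moving the base point from `o` to a site of `Δ` costs at most (1 + m)^q, so a tail at most ρ at
  -- `o` gives D times the potential at most 1 on `Δ`.
  set ρ : ℝ := 1 / (D * (1 + m : ℝ) ^ q)
  have hρ : 0 < ρ := by positivity
  let E : ℕ → Set (V → ℝ) := fun n => {η | ENNReal.ofReal ρ < e n η}
  have hEm : ∀ n, MeasurableSet (E n) := fun n => measurableSet_lt measurable_const (hem n)
  have hEanti : Antitone E := fun n n' hnn η (hη : ENNReal.ofReal ρ < e n' η) =>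
    show ENNReal.ofReal ρ < e n η from hη.trans_le
      (ENNReal.tsum_mono_subtype (W η) (s := {z | z ∉ Λ n'}) (t := {z | z ∉ Λ n})
        fun z hz hz' => hz (hΛmono hnn hz'))
  have hE0 : Filter.Tendsto (fun n => ν (E n)) Filter.atTop (nhds 0) := by
    have h0 : ν (⋂ n, E n) = 0 := by
      refine measure_mono_null ?_ (ae_iff.1 hlim)
      intro η hη hη'
      have h1 : ∀ᶠ n in Filter.atTop, e n η < ENNReal.ofReal ρ :=
        hη'.eventually_lt_const (ENNReal.ofReal_pos.2 hρ)
      obtain ⟨n, hn⟩ := h1.exists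
      exact absurd (mem_iInter.1 hη n) (not_lt.2 hn.le)
    rw [← h0]
    exact tendsto_measure_iInter_atTop (fun n => (hEm n).nullMeasurableSet) hEanti
      ⟨0, measure_ne_top _ _⟩
  have hrm : Measurable (Finset.restrict (π := fun _ : V => ℝ) Δ) :=
    measurable_pi_lambda _ fun x => measurable_pi_apply _
  have hn : ∀ n, m ≤ n → ν.map Δ.restrict A ≤ I + ν (E n) := by
    intro n hmn
    have hΔ : Δ ⊆ Λ n := fun x hx => (hΛmem n x).2 ((hm x hx).trans hmn)
    have hrm₂ : Measurable (Finset.restrict₂ (π := fun _ : V => ℝ) hΔ) :=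
      measurable_pi_lambda _ fun x => measurable_pi_apply _
    set A' : Set (Λ n → ℝ) := Finset.restrict₂ (π := fun _ : V => ℝ) hΔ ⁻¹' A
    have hA' : MeasurableSet A' := hrm₂ hA
    have hdlr := hν.dlr (Λ n) (A'.indicator 1) (measurable_one.indicator hA') ⟨1, fun φ => by
      by_cases hφ : φ ∈ A' <;> simp [hφ]⟩
    have hl : ∫ φ, A'.indicator (1 : (Λ n → ℝ) → ℝ) ((Λ n).restrict φ) ∂ν
        = (ν.map Δ.restrict).real A := by
      rw [map_measureReal_apply hrm hA, ← integral_indicator_one (hrm hA)]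
      rfl
    have hr : ∀ η, ∫ φ, A'.indicator (1 : (Λ n → ℝ) → ℝ) φ
        ∂(phi4Measure g a J.coupling β h (Λ n) η)
        = (phi4Measure g a J.coupling β h (Λ n) η).real A' := fun η => integral_indicator_one hA'
    have hfinite : ∀ η, phi4Measure g a J.coupling β h (Λ n) η A' ≤ 1 := fun η =>
      (measure_mono (subset_univ _)).trans (phi4Measure_univ_le_one _ _ _ _ _ _ _)
    simp_rw [hr] at hdlr
    rw [hl] at hdlr
    have hmap : IsProbabilityMeasure (ν.map Δ.restrict) :=
      Measure.isProbabilityMeasure_map hrm.aemeasurable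
    -- On the bad event the trivial bound 1 is used, as its probability tends to 0; off it, the
    -- finite-volume estimate applies to η cut off inside the ball.
    have hptw : ∀ η, phi4Measure g a J.coupling β h (Λ n) η A' ≤ I + (E n).indicator 1 η := by
      intro η
      by_cases hη : η ∈ E n
      · rw [indicator_of_mem hη]
        exact (hfinite η).trans le_add_self
      rw [indicator_of_notMem hη, add_zero, ← phi4Measure_indicator_compl]
      set η' := (Λ n : Set V)ᶜ.indicator η
      have hsq : ∀ z, η' z ^ 2 = (Λ n : Set V)ᶜ.indicator (fun z => η z ^ 2) z := fun z => by
        by_cases hz : z ∈ (Λ n : Set V)ᶜ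
        · simp only [η', indicator_of_mem hz]
        · simp only [η', indicator_of_notMem hz]; norm_num
      have hterm : ∀ z, 0 ≤ decayKernel G q o z * η' z ^ 2 := fun z =>
        mul_nonneg (decayKernel_pos _ _ _).le (sq_nonneg _)
      have hle : ∑' z, ENNReal.ofReal (decayKernel G q o z * η' z ^ 2) ≤ ENNReal.ofReal ρ := by
        refine le_trans (le_of_eq ?_) (not_lt.1 hη)
        refine Eq.trans ?_ (tsum_subtype (Λ n : Set V)ᶜ (W η)).symm
        refine tsum_congr fun z => ?_
        rw [hsq]
        by_cases hz : z ∈ (Λ n : Set V)ᶜ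
        · simp only [W, indicator_of_mem hz]
        · simp only [indicator_of_notMem hz]; simp
      have hsum : Summable fun z => decayKernel G q o z * η' z ^ 2 := by
        refine (ENNReal.summable_toReal (ne_top_of_le_ne_top ENNReal.ofReal_ne_top hle)).congr
          fun z => ENNReal.toReal_ofReal (hterm z)
      have hsumle : ∑' z, decayKernel G q o z * η' z ^ 2 ≤ ρ := by
        rw [← ENNReal.ofReal_tsum_of_nonneg hterm hsum] at hle
        exact (ENNReal.ofReal_le_ofReal_iff hρ.le).1 hle
      have hsumx := summable_decayKernel_mul_of_base hconn hq (fun x => sq_nonneg (η' x)) hsum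
      have hP := P η' fun x => ((hsumx x).mul_left K).of_nonneg_of_le
        (fun y => mul_nonneg (J.nonneg _ _) (sq_nonneg _)) fun y => by
          rw [← mul_assoc]
          exact mul_le_mul_of_nonneg_right (hJK x y) (sq_nonneg _)
      have hfinal := hbound η' hP hsumx (Λ n) Δ hΔ (fun x hx => ?_) A hA
      · rwa [Measure.map_apply hrm₂ hA] at hfinal
      have hpot : boundaryPotential G q (Λ n) η' x ≤ (1 + m : ℝ) ^ q * ρ := by
        have hi : ∀ z, (Λ n : Set V)ᶜ.indicator (fun z => η' z ^ 2) z = η' z ^ 2 := fun z => by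
          by_cases hz : z ∈ (Λ n : Set V)ᶜ
          · simp only [indicator_of_mem hz]
          · rw [hsq]; simp only [indicator_of_notMem hz]
        rw [boundaryPotential]
        simp_rw [hi]
        refine (Summable.tsum_le_tsum (fun z => ?_) (hsumx x)
          (hsum.mul_left ((1 + m : ℝ) ^ q))).trans ?_
        · rw [← mul_assoc]
          refine mul_le_mul_of_nonneg_right ((decayKernel_le_mul (o := o) hconn hq x z).trans ?_)
            (sq_nonneg _)
          refine mul_le_mul_of_nonneg_right (Real.rpow_le_rpow (by positivity) ?_ hq)
            (decayKernel_pos _ _ _).le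
          have : (G.dist o x : ℝ) ≤ m := by exact_mod_cast hm x hx
          linarith
        · rw [tsum_mul_left]
          exact mul_le_mul_of_nonneg_left hsumle (by positivity)
      calc D * boundaryPotential G q (Λ n) η' x ≤ D * ((1 + m : ℝ) ^ q * ρ) :=
            mul_le_mul_of_nonneg_left hpot hD.le
        _ = 1 := by simp only [ρ]; field_simp
    -- Bounding the Bochner integral by the `lintegral` of norms avoids proving that the
    -- finite-volume measure depends measurably on η.
    calc ν.map Δ.restrict A = ‖(ν.map Δ.restrict).real A‖ₑ := by
          rw [Real.enorm_of_nonneg measureReal_nonneg, ofReal_measureReal]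
      _ ≤ ∫⁻ η, ‖(phi4Measure g a J.coupling β h (Λ n) η).real A'‖ₑ ∂ν := by
          rw [hdlr]
          exact enorm_integral_le_lintegral_enorm _
      _ ≤ ∫⁻ η, (I + (E n).indicator 1 η) ∂ν := by
          refine lintegral_mono fun η => ?_
          rw [Real.enorm_of_nonneg measureReal_nonneg,
            ofReal_measureReal (ne_top_of_le_ne_top ENNReal.one_ne_top (hfinite η))]
          exact hptw η
      _ = I + ν (E n) := by
          rw [lintegral_add_left measurable_const, lintegral_const, measure_univ, mul_one,
            lintegral_indicator_one (hEm n)]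
  have hlim' : Filter.Tendsto (fun n => I + ν (E n)) Filter.atTop (nhds (I + 0)) :=
    hE0.const_add I
  rw [add_zero] at hlim'
  exact ge_of_tendsto hlim' (Filter.eventually_atTop.2 ⟨m, hn⟩)

end GibbsMeasures

/-! ### Boundary conditions of logarithmic growth -/

section WeakGrowth

variable {V : Type*} {G : SimpleGraph V} {o : V} {d : ℝ}

/-- From log t ≤ t^α/α: the configuration grows more slowly than any power, so α can be chosen at
will. -/
lemma plusConfig_sq_le {M α : ℝ} (hM : 0 < M) (hα : 0 < α) (z : V) :
    plusConfig G o M z ^ 2 ≤ (M / α) ^ (1 / 2 : ℝ) * max (G.dist o z : ℝ) 1 ^ (α / 2) := by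
  set t := max (G.dist o z : ℝ) 1
  have ht : 1 ≤ t := le_max_right _ _
  have hlog := Real.log_nonneg ht
  have h1 : plusConfig G o M z ^ 2 = (M * Real.log t) ^ (1 / 2 : ℝ) := by
    rw [plusConfig, ← Real.rpow_natCast, ← Real.rpow_mul (mul_nonneg hM.le hlog)]
    norm_num
  have h2 : M * Real.log t ≤ M / α * t ^ α := by
    have := mul_le_mul_of_nonneg_left (Real.log_le_rpow_div (by positivity) hα : _ ≤ t ^ α / α) hM.le
    refine this.trans_eq ?_
    ring
  rw [h1]
  refine (Real.rpow_le_rpow (mul_nonneg hM.le hlog) h2 (by norm_num)).trans_eq ?_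
  rw [Real.mul_rpow (by positivity) (by positivity), ← Real.rpow_mul (by positivity)]
  congr 2
  ring

/-- A site x at depth n^s and z outside the ball are at distance at least n^s, so n is at most a
power 1/s of that distance; then d_G(o,z) ≤ n + d_G(x,z). -/
lemma max_dist_le_of_notMem_ball (hconn : G.Connected) {s m : ℝ} {n : ℕ} (hn : 1 ≤ n) (hs : 0 < s)
    (hm1 : 1 ≤ m) (hms : 1 / s ≤ m) {x z : V} (hx : (G.dist o x : ℝ) ≤ n - (n : ℝ) ^ s)
    (hz : (n : ℝ) < G.dist o z) :
    max (G.dist o z : ℝ) 1 ≤ 2 * max (G.dist x z : ℝ) 1 ^ m := by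
  have hn' : (1 : ℝ) ≤ n := by exact_mod_cast hn
  have ht : (G.dist o z : ℝ) ≤ G.dist o x + G.dist x z := by exact_mod_cast hconn.dist_triangle
  set D := max (G.dist x z : ℝ) 1
  have hD1 : 1 ≤ D := le_max_right _ _
  have hD : (n : ℝ) ^ s ≤ D := le_trans (by linarith) (le_max_left (G.dist x z : ℝ) 1)
  have hnD : (n : ℝ) ≤ D ^ m := by
    calc (n : ℝ) = ((n : ℝ) ^ s) ^ (1 / s) := by
          rw [← Real.rpow_mul (by positivity), mul_one_div_cancel hs.ne', Real.rpow_one]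
      _ ≤ D ^ (1 / s) := Real.rpow_le_rpow (by positivity) hD (by positivity)
      _ ≤ D ^ m := Real.rpow_le_rpow_of_exponent_le hD1 hms
  have hDm : D ≤ D ^ m := by
    simpa using Real.rpow_le_rpow_of_exponent_le hD1 hm1
  have h3 : (G.dist x z : ℝ) ≤ D := le_max_left _ _
  have h4 : 0 ≤ (n : ℝ) ^ s := by positivity
  refine max_le ?_ ?_ <;> linarith

/-- Boundary conditions below the weakly growing configuration have bounded potential well inside
the domain. -/
lemma exists_boundaryPotential_le (hconn : G.Connected)
    (htrans : ∀ x y : V, ∃ γ : G ≃g G, γ x = y) (hd : 0 ≤ d) (hgrowth : HasPolynomialGrowth G o d)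
    {ε s M : ℝ} (hε : 0 < ε) (hs : 0 < s) (hM : 0 < M) :
    ∃ U : ℝ, ∀ (η : V → ℝ) (Λ : Finset V), (∀ z ∉ Λ, |η z| ≤ plusConfig G o M z) →
      (∀ z ∈ Λ, η z = 0) →
      (∀ x, Summable fun z => decayKernel G (d + ε) x z * η z ^ 2) ∧
      ∀ n : ℕ, 1 ≤ n → graphBall G o n ⊆ (Λ : Set V) → ∀ x : V,
        (G.dist o x : ℝ) ≤ n - (n : ℝ) ^ s → boundaryPotential G (d + ε) Λ η x ≤ U := by
  obtain ⟨S, hS0, hS⟩ := exists_hasSum_decayKernel hconn htrans hd hgrowth (half_pos hε)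
  set m := max 1 (1 / s)
  have hm1 : 1 ≤ m := le_max_left _ _
  have hm0 : 0 < m := by linarith
  -- Then (t^m)^(α/2) = t^(ε/2): the growth of η², read off from x instead of `o`, uses half of the
  -- surplus decay ε, and the other half keeps the sum convergent.
  set α := ε / m
  have hα : 0 < α := by positivity
  have hαε : α ≤ ε := div_le_self hε.le hm1
  set A := (M / α) ^ (1 / 2 : ℝ)
  have hA : 0 ≤ A := by positivity
  have hker : ∀ (D : ℝ), 0 < D → D ^ (-(d + ε)) * D ^ (ε / 2) = D ^ (-(d + ε / 2)) := fun D hD => by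
    rw [← Real.rpow_add hD]; congr 1; ring
  refine ⟨A * 2 ^ (α / 2) * S, fun η Λ hη hη0 => ?_⟩
  have hsq : ∀ z, η z ^ 2 ≤ A * max (G.dist o z : ℝ) 1 ^ (α / 2) := fun z => by
    by_cases hz : z ∈ Λ
    · rw [hη0 z hz]
      have := max_dist_pos G o z
      rw [zero_pow two_ne_zero]
      positivity
    · refine le_trans ?_ (plusConfig_sq_le hM hα z)
      exact sq_le_sq' (abs_le.1 (hη z hz)).1 (abs_le.1 (hη z hz)).2
  have hsumo : Summable fun z => decayKernel G (d + ε) o z * η z ^ 2 := by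
    refine ((hS o).summable.mul_left A).of_nonneg_of_le
      (fun z => mul_nonneg (decayKernel_pos _ _ _).le (sq_nonneg _)) fun z => ?_
    have hpos := max_dist_pos G o z
    calc decayKernel G (d + ε) o z * η z ^ 2
        ≤ decayKernel G (d + ε) o z * (A * max (G.dist o z : ℝ) 1 ^ (ε / 2)) := by
          refine mul_le_mul_of_nonneg_left ((hsq z).trans ?_) (decayKernel_pos _ _ _).le
          exact mul_le_mul_of_nonneg_left (Real.rpow_le_rpow_of_exponent_le (le_max_right _ _)
            (by linarith)) hA
      _ = A * decayKernel G (d + ε / 2) o z := by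
          rw [decayKernel, decayKernel, ← hker _ hpos]; ring
  have hsumx := summable_decayKernel_mul_of_base hconn (by positivity) (fun x => sq_nonneg (η x))
    hsumo
  refine ⟨hsumx, fun n hn hball x hx => ?_⟩
  rw [boundaryPotential, ← (hS x).tsum_eq, ← tsum_mul_left]
  refine Summable.tsum_le_tsum (fun z => ?_) (summable_decayKernel_mul_indicator hsumx Λ x)
    ((hS x).summable.mul_left _)
  have hpos := max_dist_pos G x z
  by_cases hz : z ∈ Λ
  · have := decayKernel_pos (G := G) (d + ε / 2) x z
    rw [indicator_of_notMem (by simpa using hz), mul_zero]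
    positivity
  · rw [indicator_of_mem (by simpa using hz)]
    have hzn : (n : ℝ) < G.dist o z := by
      have : ¬ G.dist o z ≤ n := fun h' => hz (hball h')
      exact_mod_cast not_le.1 this
    have h1 := max_dist_le_of_notMem_ball hconn hn hs hm1 (le_max_right 1 (1 / s)) hx hzn
    have h2 : max (G.dist o z : ℝ) 1 ^ (α / 2)
        ≤ 2 ^ (α / 2) * max (G.dist x z : ℝ) 1 ^ (ε / 2) := by
      refine (Real.rpow_le_rpow (max_dist_pos G o z).le h1 (by positivity)).trans_eq ?_
      rw [Real.mul_rpow (by norm_num) (by positivity), ← Real.rpow_mul hpos.le]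
      congr 2
      simp only [α]
      field_simp
    calc decayKernel G (d + ε) x z * η z ^ 2
        ≤ decayKernel G (d + ε) x z * (A * (2 ^ (α / 2) * max (G.dist x z : ℝ) 1 ^ (ε / 2))) :=
          mul_le_mul_of_nonneg_left ((hsq z).trans (mul_le_mul_of_nonneg_left h2 hA))
            (decayKernel_pos _ _ _).le
      _ = A * 2 ^ (α / 2) * decayKernel G (d + ε / 2) x z := by
          rw [decayKernel, decayKernel, ← hker _ hpos]; ring

end WeakGrowth

/-! ### Choice of constants and their continuity -/

section Regularity

variable {V : Type*} {G : SimpleGraph V} {o : V} {d : ℝ}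

/-- A common bound on the parameters of the model and their inverses, where `L` bounds the row sums
of the interaction. -/
noncomputable def parameterSize (g a L β : ℝ) (h : lp (fun _ : V => ℝ) ∞) : ℝ :=
  1 + g + g⁻¹ + |a| + L + β + ‖h‖

lemma parameterSize_pos {g a L β : ℝ} (h : lp (fun _ : V => ℝ) ∞) (hg : 0 < g) (hL : 0 ≤ L)
    (hβ : 0 < β) : 0 < parameterSize g a L β h := by
  unfold parameterSize; positivity

lemma parameterBound_parameterSize {g a L β : ℝ} {h : lp (fun _ : V => ℝ) ∞} {J : V → V → ℝ}
    {η : V → ℝ} (hg : 0 < g) (hL : 0 ≤ L) (hβ : 0 < β) (hJ : ∀ x y, 0 ≤ J x y)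
    (hsymm : ∀ x y, J x y = J y x) (hsum : ∀ x, Summable (J x)) (hrow : ∀ x, ∑' y, J x y ≤ L)
    (hη : ∀ x, Summable fun y => J x y * η y ^ 2) :
    ParameterBound (parameterSize g a L β h) g a J β h η := by
  have h1 := inv_pos.2 hg
  have h2 := abs_nonneg a
  have h3 := norm_nonneg h
  have hg' : g⁻¹ ≤ parameterSize g a L β h := by unfold parameterSize; linarith
  refine ⟨hg, ?_, one_le_mul_of_inv_le hg hg', ?_, hβ.le, ?_, fun x => ?_, hJ, hsymm, hsum,
    fun x => (hrow x).trans ?_, hη⟩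
  · unfold parameterSize; linarith
  · unfold parameterSize; linarith
  · unfold parameterSize; linarith
  · have := lp.norm_apply_le_norm ENNReal.top_ne_zero h x
    rw [Real.norm_eq_abs] at this
    unfold parameterSize; linarith
  · unfold parameterSize; linarith

/-- The interaction enters `R` only through its row sum, which is continuous for the given topology;
this is why δ is continuous in J. -/
theorem gibbs_regular (hconn : G.Connected) (htrans : ∀ x y : V, ∃ γ : G ≃g G, γ x = y)
    (hd : 0 ≤ d) (hgrowth : HasPolynomialGrowth G o d) :
    ∃ γ δ : ℝ × ℝ × AdmissibleInteraction G d × ℝ × lp (fun _ : V => ℝ) ∞ → ℝ,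
      ContinuousOn γ {p | 0 < p.1 ∧ 0 < p.2.2.2.1} ∧
      ContinuousOn δ {p | 0 < p.1 ∧ 0 < p.2.2.2.1} ∧
      ∀ (g a : ℝ) (J : AdmissibleInteraction G d) (β : ℝ) (h : lp (fun _ : V => ℝ) ∞),
        0 < g → 0 < β →
          0 < γ (g, a, J, β, h) ∧ 0 < δ (g, a, J, β, h) ∧
          ∀ ν : Measure (V → ℝ), IsGibbs G o g a J.coupling β h ν →
            IsRegularMeasure (γ (g, a, J, β, h)) (δ (g, a, J, β, h)) ν := by
  let R : ℝ × ℝ × AdmissibleInteraction G d × ℝ × lp (fun _ : V => ℝ) ∞ → ℝ :=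
    fun p => parameterSize p.1 p.2.1 (rowSum o p.2.2.1) p.2.2.2.1 p.2.2.2.2
  have hRpos : ∀ p ∈ {p : ℝ × ℝ × AdmissibleInteraction G d × ℝ × lp (fun _ : V => ℝ) ∞ |
      0 < p.1 ∧ 0 < p.2.2.2.1}, 0 < R p := fun p hp =>
    parameterSize_pos _ hp.1 p.2.2.1.rowSum_nonneg hp.2
  have hR : ContinuousOn R {p | 0 < p.1 ∧ 0 < p.2.2.2.1} := by
    have h1 := AdmissibleInteraction.continuous_rowSum hconn htrans hd hgrowth
    have h2 : ContinuousOn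
        (fun p : ℝ × ℝ × AdmissibleInteraction G d × ℝ × lp (fun _ : V => ℝ) ∞ => p.1⁻¹)
        {p | 0 < p.1 ∧ 0 < p.2.2.2.1} := continuousOn_fst.inv₀ fun p hp => hp.1.ne'
    simp only [R, parameterSize]
    fun_prop
  refine ⟨fun p => p.1 / 2, fun p => 2 * stepConst (R p) (1 / (2 * R p)) + 2, by fun_prop, ?_, ?_⟩
  · refine (continuousOn_const.mul (hR.stepConst ?_ fun p hp => ?_)).add continuousOn_const
    · refine continuousOn_const.div (continuousOn_const.mul hR) fun p hp => ?_
      have := hRpos p hp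
      positivity
    · have := hRpos p hp
      positivity
  · intro g a J β h hg hβ
    have hR0 : 0 < R (g, a, J, β, h) := hRpos (g, a, J, β, h) ⟨hg, hβ⟩
    refine ⟨half_pos hg, ?_, fun ν hν Δ => hasQuarticDensityBound_of_forall_le fun A hA => ?_⟩
    · have := stepConst_pos hR0 (κ := 1 / (2 * R (g, a, J, β, h))) (by positivity)
      positivity
    · exact map_restrict_le_of_isGibbs hconn htrans hd hgrowth
        (fun η hη => parameterBound_parameterSize hg J.rowSum_nonneg hβ J.nonneg J.symm
          (J.summable hconn htrans hd hgrowth) (fun x => (J.tsum_eq_rowSum x).le) hη) hR0 hν Δ hA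

/-- Here the constant may depend on the decay bound `K`, so one supersolution suffices. Row sums are
at most K S, which removes J from the constant. -/
theorem finiteVolume_regular (hconn : G.Connected) (htrans : ∀ x y : V, ∃ γ : G ≃g G, γ x = y)
    (hd : 0 ≤ d) (hgrowth : HasPolynomialGrowth G o d) {ε s M : ℝ} (hε : 0 < ε) (hs : 0 < s)
    (hM : 0 < M) :
    ∃ c : ℝ × ℝ × ℝ × ℝ × lp (fun _ : V => ℝ) ∞ → ℝ,
      ContinuousOn c {p | 0 < p.1 ∧ 0 < p.2.2.1 ∧ 0 < p.2.2.2.1} ∧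
      ∀ (g a K β : ℝ) (h : lp (fun _ : V => ℝ) ∞), 0 < g → 0 < K → 0 < β →
        0 < c (g, a, K, β, h) ∧
        ∀ J : AdmissibleInteraction G d,
          (∀ x y, J.coupling x y ≤ K * (max (G.dist x y : ℝ) 1) ^ (-(d + ε))) →
          ∀ n : ℕ, 1 ≤ n → ∀ (Λ Δ : Finset V) (hΔΛ : Δ ⊆ Λ),
            graphBall G o n ⊆ (Λ : Set V) →
            (∀ x ∈ Δ, (G.dist o x : ℝ) ≤ n - (n : ℝ) ^ s) →
            ∀ η : V → ℝ, (∀ z ∉ Λ, |η z| ≤ plusConfig G o M z) →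
              HasQuarticDensityBound (Λ := Δ) (g / 2) (c (g, a, K, β, h))
                ((phi4Measure g a J.coupling β h Λ η).map
                  (Finset.restrict₂ (π := fun _ => ℝ) hΔΛ)) := by
  obtain ⟨S, hS0, hS⟩ := exists_hasSum_decayKernel hconn htrans hd hgrowth hε
  obtain ⟨U, hU⟩ := exists_boundaryPotential_le hconn htrans hd hgrowth hε hs hM
  have hq : 0 ≤ d + ε := by positivity
  let D := {p : ℝ × ℝ × ℝ × ℝ × lp (fun _ : V => ℝ) ∞ | 0 < p.1 ∧ 0 < p.2.2.1 ∧ 0 < p.2.2.2.1}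
  let R : ℝ × ℝ × ℝ × ℝ × lp (fun _ : V => ℝ) ∞ → ℝ :=
    fun p => parameterSize p.1 p.2.1 (p.2.2.1 * S) p.2.2.2.1 p.2.2.2.2
  let κ : ℝ × ℝ × ℝ × ℝ × lp (fun _ : V => ℝ) ∞ → ℝ :=
    fun p => supersolutionInfluence (d + ε) S (R p) p.2.2.1
  have hRpos : ∀ p ∈ D, 0 < R p := fun p hp =>
    parameterSize_pos _ hp.1 (mul_nonneg hp.2.1.le hS0.le) hp.2.2
  have hden : ∀ p ∈ D, 0 < 2 * R p + p.2.2.1 * (1 + 2 ^ (d + ε) * (2 * S)) := fun p hp => by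
    have h1 := hRpos p hp
    have h2 : 0 < p.2.2.1 := hp.2.1
    positivity
  have hκpos : ∀ p ∈ D, 0 < κ p := fun p hp => one_div_pos.2 (hden p hp)
  have hR : ContinuousOn R D := by
    have h2 : ContinuousOn (fun p : ℝ × ℝ × ℝ × ℝ × lp (fun _ : V => ℝ) ∞ => p.1⁻¹) D :=
      continuousOn_fst.inv₀ fun p hp => hp.1.ne'
    simp only [R, parameterSize]
    fun_prop
  have hκ : ContinuousOn κ D :=
    continuousOn_const.div (by fun_prop) fun p hp => (hden p hp).ne'
  -- The absolute value keeps the constant positive, as no sign of `U` is recorded.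
  refine ⟨fun p => 2 * stepConst (R p) (κ p) + |U|,
    (continuousOn_const.mul (hR.stepConst hκ hκpos)).add continuousOn_const, ?_⟩
  intro g a K β h hg hK hβ
  have hp : (g, a, K, β, h) ∈ D := ⟨hg, hK, hβ⟩
  refine ⟨?_, fun J hJK n hn Λ Δ hΔΛ hball hΔ η hη => ?_⟩
  · have := stepConst_pos (hRpos _ hp) (hκpos _ hp)
    positivity
  · refine hasQuarticDensityBound_of_forall_le fun A hA => ?_
    rw [← phi4Measure_indicator_compl]
    set η' := (Λ : Set V)ᶜ.indicator η
    obtain ⟨hsum, hpot⟩ := hU η' Λ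
      (fun z hz => by
        simp only [η', indicator_of_mem (show z ∈ (Λ : Set V)ᶜ by simpa using hz)]
        exact hη z hz)
      (fun z hz => indicator_of_notMem (by simpa using hz) _)
    have hJK' : ∀ x y, J.coupling x y ≤ K * decayKernel G (d + ε) x y := hJK
    have hrow : ∀ x, ∑' y, J.coupling x y ≤ K * S := fun x => by
      rw [← (hS x).tsum_eq, ← tsum_mul_left]
      exact Summable.tsum_le_tsum (hJK' x) (J.summable hconn htrans hd hgrowth x)
        ((hS x).summable.mul_left K)
    have P : ParameterBound (R (g, a, K, β, h)) g a J.coupling β h η' :=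
      parameterBound_parameterSize hg (by positivity) hβ J.nonneg J.symm
        (J.summable hconn htrans hd hgrowth) hrow fun x =>
          ((hsum x).mul_left K).of_nonneg_of_le
            (fun y => mul_nonneg (J.nonneg _ _) (sq_nonneg _)) fun y => by
              rw [← mul_assoc]
              exact mul_le_mul_of_nonneg_right (hJK' x y) (sq_nonneg _)
    exact P.map_restrict₂_le_of_boundaryPotential_le hconn hq hS0.le hS hK.le hJK' hsum hΔΛ
      (fun x hx => (hpot n hn hball x (hΔ x hx)).trans (le_abs_self U)) hA

end Regularity

theorem proposition2p2 {V : Type*} (G : SimpleGraph V) (o : V) (d : ℝ)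
    (hconn : G.Connected)
    (hlf : ∀ x, (G.neighborSet x).Finite)
    (htrans : ∀ x y : V, ∃ γ : G ≃g G, γ x = y)
    (hd : 1 ≤ d)
    (hgrowth : HasPolynomialGrowth G o d) :
    -- Gibbs measures are regular, with constants that are continuous in `(g, a, J, β, h)`
    (∃ γ δ : ℝ × ℝ × AdmissibleInteraction G d × ℝ × lp (fun _ : V => ℝ) ∞ → ℝ,
      ContinuousOn γ {p | 0 < p.1 ∧ 0 < p.2.2.2.1} ∧
      ContinuousOn δ {p | 0 < p.1 ∧ 0 < p.2.2.2.1} ∧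
      ∀ (g a : ℝ) (J : AdmissibleInteraction G d) (β : ℝ) (h : lp (fun _ : V => ℝ) ∞),
        0 < g → 0 < β →
          0 < γ (g, a, J, β, h) ∧ 0 < δ (g, a, J, β, h) ∧
          ∀ ν : Measure (V → ℝ), IsGibbs G o g a J.coupling β h ν →
            IsRegularMeasure (γ (g, a, J, β, h)) (δ (g, a, J, β, h)) ν) ∧
    -- uniform bounds for finite-volume measures with boundary conditions below `𝔭`,
    -- with a constant that is continuous in `(g, a, K, β, h)`
    (∀ ε s M : ℝ, 0 < ε → 0 < s → 0 < M →
      ∃ c : ℝ × ℝ × ℝ × ℝ × lp (fun _ : V => ℝ) ∞ → ℝ,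
        ContinuousOn c {p | 0 < p.1 ∧ 0 < p.2.2.1 ∧ 0 < p.2.2.2.1} ∧
        ∀ (g a K β : ℝ) (h : lp (fun _ : V => ℝ) ∞), 0 < g → 0 < K → 0 < β →
          0 < c (g, a, K, β, h) ∧
          ∀ J : AdmissibleInteraction G d,
            (∀ x y, J.coupling x y ≤ K * (max (G.dist x y : ℝ) 1) ^ (-(d + ε))) →
            ∀ n : ℕ, 1 ≤ n → ∀ (Λ Δ : Finset V) (hΔΛ : Δ ⊆ Λ),
              graphBall G o n ⊆ (Λ : Set V) →
              (∀ x ∈ Δ, (G.dist o x : ℝ) ≤ n - (n : ℝ) ^ s) →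
              ∀ η : V → ℝ, (∀ z ∉ Λ, |η z| ≤ plusConfig G o M z) →
                HasQuarticDensityBound (Λ := Δ) (g / 2) (c (g, a, K, β, h))
                  ((phi4Measure g a J.coupling β h Λ η).map (Finset.restrict₂ (π := fun _ => ℝ) hΔΛ))) := by
  have hd0 : 0 ≤ d := zero_le_one.trans hd
  exact ⟨gibbs_regular hconn htrans hd0 hgrowth,
    fun _ _ _ hε hs hM => finiteVolume_regular hconn htrans hd0 hgrowth hε hs hM⟩
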